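/- Let $\mathcal M$ be a finite nonempty set, let ${\bm P}$ be an irreducible transition matrix on $\mathcal M$ with ${\bm P}(m,m)>0$ for all $m$ (so ${\bm P}$ is also aperiodic), with stationary distribution ${\bm\pi}$, and for each $m\in\mathcal M$ let $\lambda(m)>0$, $\mu_1(m)\ge 0$, $\mu_2(m)>0$ with $\lambda(m)+\mu_1(m)+\mu_2(m)=1$. Let $(Y,M)$ be the Markov chain on $\mathbb Z\times\mathbb Z_+\times\mathcal M$ in which $M$ is a Markov chain with transition matrix ${\bm P}$; if $M$ changes its state in a step then $Y$ does not move, and if $M$ stays in $m$ then $Y$ makes the jump $(-1,0)$, $(1,1)$, $(0,-1)$ with probability $\lambda(m)$, $\mu_1(m)$, $\mu_2(m)$ respectively, where a jump that would leave $\mathbb Z\times\mathbb Z_+$ is suppressed. Let $B=\{y\in\mathbb Z\times\mathbb Z_+: y(1)\ge y(2)\}$, $\partial B=\{y\in\mathbb Z\times\mathbb Z_+: y(1)=y(2)\}$, $\tau=\inf\{k\ge0: Y_k\in\partial B\}$. A function $h$ on $\mathbb Z\times\mathbb Z_+\times\mathcal M$ is harmonic if $\mathbb E_{(y,m)}[h(Y_1,M_1)]=h(y,m)$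 for all $(y,m)$; a harmonic $h$ is $\partial B$-determined if for some function $f$, $h(y,m)=\mathbb E_{(y,m)}[f(Y_\tau,M_\tau)1_{\{\tau<\infty\}}]$ for all $y\in B$, $m\in\mathcal M$ (with integrability). For $\beta,\alpha>0$ let ${\bm A}(\beta,\alpha)$ and ${\bm A}_2(\beta,\alpha)$ be the $\mathcal M\times\mathcal M$ matrices with off-diagonal entries ${\bm P}(m,n)$ and diagonal entries ${\bm P}(m,m)\bigl(\lambda(m)/\beta+\mu_1(m)\alpha+\mu_2(m)\beta/\alpha\bigr)$, respectively ${\bm P}(m,m)\bigl(\lambda(m)/\beta+\mu_1(m)\alpha+\mu_2(m)\bigr)$. For ${\bm d}\in\mathbb R^{\mathcal M}$ put $$[(\beta,\alpha,{\bm d}),(y,m)]=\beta^{y(1)-y(2)}\alpha^{y(2)}{\bm d}(m),\qquad {\bm c}(\beta,\alpha,{\bm d})(m)={\bm P}(m,m)\mu_2(m){\bm d}(m)(1-\beta/\alpha).$$ Assume the stability condition $\sum_m(\lambda(m)-\mu_i(m)){\bm\pi}(m){\bm P}(m,m)<0$ for $i=1,2$, and assume that for all $\beta,\alpha>0$ the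 eigenvalues of ${\bm A}(\beta,\alpha)$ are real and distinct; write them as $\Lambda_1>\Lambda_2>\dots>\Lambda_{|\mathcal M|}$. Let $\rho_1\in(0,1)$ be such that $1$ is the largest eigenvalue of ${\bm A}(\rho_1,\rho_1)$ and of ${\bm A}_2(\rho_1,\rho_1)$, and let $\rho_2\in(0,1)$ be such that $1$ is the largest eigenvalue of ${\bm A}(\rho_2,1)$. Assume $$\sum_{m}(\rho_2\mu_2(m)-\mu_1(m)){\bm P}(m,m)\det\bigl(({\bm I}-{\bm A}(\rho_2,1))^{m,m}\bigr)<0,$$ where the superscript $m,m$ means that row and column $m$ are removed. Let ${\bm d}_1,{\bm d}_2$ be eigenvectors with strictly positive components, for the eigenvalue $1$, of ${\bm A}(\rho_1,\rho_1)$ and ${\bm A}(\rho_2,1)$; let $\alpha_1^*\in(0,1)$ with $\Lambda_1(\rho_2,\alpha_1^*)=1$, let $\alpha_j^*\in(0,\alpha_1^*)$ with $\Lambda_j(\rho_2,\alpha_j^*)=1$ for $j=2,\dots,|\mathcal M|$, and let ${\bm d}_{2,j}\ne0$ be real with ${\bm A}(\rho_2,\alpha_j^*){\bm d}_{2,j}={\bm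 d}_{2,j}$, $j=1,\dots,|\mathcal M|$. All of these objects exist. Suppose that moreover, for such a choice, ${\bm c}(\rho_2,1,{\bm d}_2)\in\mathrm{Span}\bigl({\bm c}(\rho_2,\alpha_j^*,{\bm d}_{2,j}),\ j=1,\dots,|\mathcal M|\bigr)$. Then there is ${\bm b}\in\mathbb R^{|\mathcal M|}$ such that $$\mathfrak h_{\rho_2}=[(\rho_2,1,{\bm d}_2),\cdot]+\sum_{j=1}^{|\mathcal M|}{\bm b}(j)[(\rho_2,\alpha_j^*,{\bm d}_{2,j}),\cdot]$$ is harmonic and $\partial B$-determined. Let $h_{\rho_1}=[(\rho_1,\rho_1,{\bm d}_1),\cdot]$. For every ${\bm b}$ for which $\mathfrak h_{\rho_2}$ is harmonic there are constants $c_9,c_{10},c_{11}$ such that $h^{a,0}=c_{11}(\mathfrak h_{\rho_2}+c_{10}h_{\rho_1})$ is harmonic and $\partial B$-determined and $$\mathbb P_{(y,m)}(\tau<\infty)<h^{a,0}(y,m)<c_9\,\mathbb P_{(y,m)}(\tau<\infty)\qquad\text{for all } y\in B,\ m\in\mathcal M.$$ -/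

import Mathlib

open MeasureTheory ProbabilityTheory

noncomputable section

/-- Parameters of the Markov modulated tandem walk: the transition matrix `P` of the modulating
chain and, for each modulating state `m`, the jump probabilities `lam m`, `mu1 m`, `mu2 m`. -/
structure ModulatedTandem (S : Type*) [Fintype S] where
  P : Matrix S S ℝ
  lam : S → ℝ
  mu1 : S → ℝ
  mu2 : S → ℝ
  P_nonneg : ∀ m n, 0 ≤ P m n
  P_sum : ∀ m, ∑ n, P m n = 1
  P_diag_pos : ∀ m, 0 < P m m
  lam_pos : ∀ m, 0 < lam m
  mu1_nonneg : ∀ m, 0 ≤ mu1 m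
  mu2_pos : ∀ m, 0 < mu2 m
  rate_sum : ∀ m, lam m + mu1 m + mu2 m = 1

/-- A state `(y, m)` of the limit process: `y = (y1, y2) ∈ ℤ × ℤ₊`, `m` the modulating state. -/
@[ext] structure TandemState (S : Type*) where
  y1 : ℤ
  y2 : ℕ
  mode : S

namespace TandemState

variable {S : Type*}

/-- Every set of states is measurable. -/
instance : MeasurableSpace (TandemState S) := ⊤

/-- Jump by `v`, constrained to `ℤ × ℤ₊`: the jump is suppressed if it would leave this set. -/
def jump (s : TandemState S) (v : ℤ × ℤ) : TandemState S :=
  if 0 ≤ (s.y2 : ℤ) + v.2 then ⟨s.y1 + v.1, ((s.y2 : ℤ) + v.2).toNat, s.mode⟩ else s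

/-- The region `B = {y1 ≥ y2}`. -/
def regionB (S : Type*) : Set (TandemState S) := {s | (s.y2 : ℤ) ≤ s.y1}

/-- The exit boundary `∂B = {y1 = y2}`. -/
def boundaryB (S : Type*) : Set (TandemState S) := {s | s.y1 = (s.y2 : ℤ)}

/-- The exponential function `(y, m) ↦ β ^ (y1 - y2) * α ^ y2 * d m`. -/
def expFun (β α : ℝ) (d : S → ℝ) (s : TandemState S) : ℝ :=
  β ^ (s.y1 - (s.y2 : ℤ)) * α ^ s.y2 * d s.mode

/-- The hitting time `τ` of `∂B` (equal to `⊤` on paths that never hit `∂B`). -/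
def tau : (ℕ → TandemState S) → WithTop ℕ :=
  hittingAfter (fun k (ω : ℕ → TandemState S) => ω k) (boundaryB S) 0

end TandemState

/-- The real number `x` is the `(k+1)`-st largest among the real eigenvalues of `A`:
an eigenvalue of `A` such that exactly `k` real eigenvalues of `A` are greater than `x`. -/
def IsKthEigenvalue {S : Type*} [Fintype S] [DecidableEq S] (A : Matrix S S ℝ) (k : ℕ)
    (x : ℝ) : Prop :=
  Module.End.HasEigenvalue (Matrix.toLin' A) x ∧
    {z : ℝ | Module.End.HasEigenvalue (Matrix.toLin' A) z ∧ x < z}.ncard = k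

namespace ModulatedTandem

variable {S : Type*} [Fintype S] [DecidableEq S] (W : ModulatedTandem S)

open TandemState

/-- One-step law of `(Y, M)`: the modulating chain moves from `m` to `n` with probability `P m n`;
if `n ≠ m` then `Y` does not move, and if `n = m` then `Y` makes the constrained jump
`(-1, 0)`, `(1, 1)`, `(0, -1)` with probability `lam m`, `mu1 m`, `mu2 m`. -/
def stepLaw (s : TandemState S) : Measure (TandemState S) :=
  ∑ n : S, ENNReal.ofReal (W.P s.mode n) •
    (if n = s.mode then
      ENNReal.ofReal (W.lam s.mode) • Measure.dirac (s.jump (-1, 0)) +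
      ENNReal.ofReal (W.mu1 s.mode) • Measure.dirac (s.jump (1, 1)) +
      ENNReal.ofReal (W.mu2 s.mode) • Measure.dirac (s.jump (0, -1))
    else Measure.dirac ⟨s.y1, s.y2, n⟩)

/-- The one-step transition kernel of `(Y, M)`. -/
def stepKernel : Kernel (TandemState S) (TandemState S) where
  toFun := W.stepLaw
  measurable' := measurable_from_top

instance : IsMarkovKernel W.stepKernel := by
  refine ⟨fun s => ⟨?_⟩⟩
  change W.stepLaw s Set.univ = 1
  have hr : ENNReal.ofReal (W.lam s.mode) + ENNReal.ofReal (W.mu1 s.mode) +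
      ENNReal.ofReal (W.mu2 s.mode) = 1 := by
    rw [← ENNReal.ofReal_add (W.lam_pos _).le (W.mu1_nonneg _),
      ← ENNReal.ofReal_add (add_nonneg (W.lam_pos _).le (W.mu1_nonneg _)) (W.mu2_pos _).le,
      W.rate_sum, ENNReal.ofReal_one]
  have h1 : ∀ n : S, ((if n = s.mode then
      ENNReal.ofReal (W.lam s.mode) • Measure.dirac (s.jump (-1, 0)) +
      ENNReal.ofReal (W.mu1 s.mode) • Measure.dirac (s.jump (1, 1)) +
      ENNReal.ofReal (W.mu2 s.mode) • Measure.dirac (s.jump (0, -1))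
    else Measure.dirac ⟨s.y1, s.y2, n⟩ : Measure (TandemState S))) Set.univ = 1 := by
    intro n
    split_ifs
    · simpa using hr
    · simp
  simp only [stepLaw, Measure.coe_finsetSum, Finset.sum_apply, Measure.smul_apply, h1,
    smul_eq_mul, mul_one]
  rw [← ENNReal.ofReal_sum_of_nonneg (fun n _ => W.P_nonneg _ n), W.P_sum, ENNReal.ofReal_one]

/-- The law, on the space of paths, of the Markov chain `(Y, M)` started from `s`. -/
def pathLaw (s : TandemState S) : Measure (ℕ → TandemState S) :=
  Kernel.traj (X := fun _ => TandemState S)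
    (fun n => W.stepKernel.comap
      (fun x : (i : Finset.Iic n) → TandemState S => x ⟨n, Finset.mem_Iic.2 le_rfl⟩)
      (measurable_pi_apply _)) 0 (fun _ => s)

/-- The probability that `(Y, M)`, started from `s`, ever hits `∂B`. -/
def hitProb (s : TandemState S) : ℝ := (W.pathLaw s).real {ω | tau ω < ⊤}

/-- `(Y, M)`-harmonic functions: the expectation of `h (Y_1, M_1)` from `s` equals `h s`. -/
def IsHarmonic (h : TandemState S → ℝ) : Prop :=
  ∀ s, ∫ z, h z ∂(W.stepKernel s) = h s

/-- A harmonic function is `∂B`-determined if, on `B`, it is the expectation of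
`f (Y_τ, M_τ)` on the event `τ < ∞`, for some function `f`. -/
def IsBoundaryDetermined (h : TandemState S → ℝ) : Prop :=
  W.IsHarmonic h ∧ ∃ f : TandemState S → ℝ, ∀ s ∈ regionB S,
    IntegrableOn (fun ω => f (ω (tau ω).untopA)) {ω | tau ω < ⊤} (W.pathLaw s) ∧
    h s = ∫ ω in {ω | tau ω < ⊤}, f (ω (tau ω).untopA) ∂(W.pathLaw s)

/-- Stability: both drifts are negative with respect to the stationary distribution of `P`
(which is unique when `P` is irreducible). -/
def Stable : Prop :=
  ∃ π : S → ℝ, (∀ m, 0 ≤ π m) ∧ ∑ m, π m = 1 ∧ Matrix.vecMul π W.P = π ∧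
    ∑ m, (W.lam m - W.mu1 m) * π m * W.P m m < 0 ∧
    ∑ m, (W.lam m - W.mu2 m) * π m * W.P m m < 0

/-- The characteristic matrix `A(β, α)` of the interior. -/
def charMat (β α : ℝ) : Matrix S S ℝ :=
  Matrix.of fun m n =>
    if m = n then W.P m m * (W.lam m * (1 / β) + W.mu1 m * α + W.mu2 m * (β / α)) else W.P m n

/-- The characteristic matrix `A₂(β, α)` of the constraining boundary `y2 = 0`. -/
def charMat2 (β α : ℝ) : Matrix S S ℝ :=
  Matrix.of fun m n =>
    if m = n then W.P m m * (W.lam m * (1 / β) + W.mu1 m * α + W.mu2 m) else W.P m n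

/-- For all `β, α > 0` the eigenvalues of `A(β, α)` are real and distinct. -/
def SimpleEigenvalues : Prop :=
  ∀ β α : ℝ, 0 < β → 0 < α →
    {x : ℝ | Module.End.HasEigenvalue (Matrix.toLin' (W.charMat β α)) x}.ncard = Fintype.card S

/-- `(β, α)` lies on the level curve on which `1` is the `(k+1)`-st largest eigenvalue of
`A(β, α)`. -/
def OnLevel (k : ℕ) (β α : ℝ) : Prop :=
  0 < β ∧ 0 < α ∧ IsKthEigenvalue (W.charMat β α) k 1

/-- `(β, α)` lies on the level curve on which `1` is the largest eigenvalue of `A₂(β, α)`. -/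
def OnLevel2 (β α : ℝ) : Prop :=
  0 < β ∧ 0 < α ∧ IsKthEigenvalue (W.charMat2 β α) 0 1

/-- The defining property of `ρ₁`. -/
def IsRho1 (r : ℝ) : Prop := 0 < r ∧ r < 1 ∧ W.OnLevel 0 r r ∧ W.OnLevel2 r r

/-- The defining property of `ρ₂`. -/
def IsRho2 (r : ℝ) : Prop := 0 < r ∧ r < 1 ∧ W.OnLevel 0 r 1

/-- The number `ρ₁` with the property `IsRho1`. -/
def rho1 : ℝ := Classical.epsilon W.IsRho1

/-- The number `ρ₂` with the property `IsRho2`. -/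
def rho2 : ℝ := Classical.epsilon W.IsRho2

/-- `∑ (ρ₂ μ₂(m) - μ₁(m)) P(m,m) det (I - A(ρ₂,1))^{m,m} < 0`, where the superscript `m,m` means
that row and column `m` are removed. -/
def ConjCondition : Prop :=
  ∑ m, (W.rho2 * W.mu2 m - W.mu1 m) * W.P m m *
    ((1 - W.charMat W.rho2 1).submatrix (Subtype.val : {i // i ≠ m} → S)
      (Subtype.val : {i // i ≠ m} → S)).det < 0

/-- The vector `c(β, α, d)`. -/
def cVec (β α : ℝ) (d : S → ℝ) : S → ℝ :=
  fun m => W.P m m * W.mu2 m * d m * (1 - β / α)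

/-- The points on the characteristic surface from which the harmonic functions are built: positive
eigenvectors `d1` of `A(ρ₁,ρ₁)` and `d2` of `A(ρ₂,1)`, and conjugate points `(ρ₂, α j)` of `(ρ₂,1)`
with eigenvectors `e j`, where `(ρ₂, α j)` lies on the level curve of the `(j+1)`-st largest
eigenvalue, `α 0 < 1`, and `α j < α 0` for `j ≠ 0`. -/
structure ConjugatePoints where
  d1 : S → ℝ
  d1_pos : ∀ m, 0 < d1 m
  d1_eig : (W.charMat W.rho1 W.rho1).mulVec d1 = d1
  d2 : S → ℝ
  d2_pos : ∀ m, 0 < d2 m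
  d2_eig : (W.charMat W.rho2 1).mulVec d2 = d2
  α : Fin (Fintype.card S) → ℝ
  α_level : ∀ j : Fin (Fintype.card S), W.OnLevel j W.rho2 (α j)
  α_first : ∀ j : Fin (Fintype.card S), (j : ℕ) = 0 → α j < 1
  α_lt : ∀ i j : Fin (Fintype.card S), (i : ℕ) = 0 → (j : ℕ) ≠ 0 → α j < α i
  e : Fin (Fintype.card S) → S → ℝ
  e_ne : ∀ j, e j ≠ 0
  e_eig : ∀ j, (W.charMat W.rho2 (α j)).mulVec (e j) = e j

namespace ConjugatePoints

variable {W}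
variable (C : W.ConjugatePoints)

/-- `c(ρ₂, 1, d2)` lies in the span of the vectors `c(ρ₂, α j, e j)`. -/
def SpanCondition : Prop :=
  W.cVec W.rho2 1 C.d2 ∈
    Submodule.span ℝ (Set.range fun j => W.cVec W.rho2 (C.α j) (C.e j))

/-- The function `h_{ρ₁}`. -/
def hRho1 : TandemState S → ℝ := expFun W.rho1 W.rho1 C.d1

/-- The function `𝔥_{ρ₂}` with coefficient vector `b`. -/
def hRho2 (b : Fin (Fintype.card S) → ℝ) (s : TandemState S) : ℝ :=
  expFun W.rho2 1 C.d2 s + ∑ j, b j * expFun W.rho2 (C.α j) (C.e j) s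

/-- The function `h^{a,0} = c11 (𝔥_{ρ₂} + c10 h_{ρ₁})`. -/
def hApprox (b : Fin (Fintype.card S) → ℝ) (c10 c11 : ℝ) (s : TandemState S) : ℝ :=
  c11 * (C.hRho2 b s + c10 * C.hRho1 s)

end ConjugatePoints

end ModulatedTandem

end

/-! The building blocks are the functions `expFun β α d` with `A(β,α) d = d`. Where `y2 > 0` the
eigenvector equation is harmonicity; at `y2 = 0` the suppressed jump leaves the defect `β ^ y1 *
cVec β α d`. It vanishes for `β = α`, so `h_{ρ₁}` is harmonic. Terms with the common value `β = ρ₂`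
have defects with the same dependence on `y1`, so the span condition makes the linear system for the
`b` that cancels them solvable.

Probability enters through `IsHarmonic.eq_setIntegral_tau`: a harmonic `h` with `|h| ≤ C * r ^ (y1 -
y2)` on `B`, `r < 1`, is its own boundary representation. Optional stopping at `τ ∧ n` leaves a
remainder on the paths that have not yet hit `∂B`. From any bounded range of levels `y1 - y2` a left
jump has probability bounded below, so the probability of having stayed inside and still being at a
low level tends to zero; at high levels `h` is small. The representation turns bounds on `∂B` into
multiples of the hitting probability. On `∂B` the term `d2` of `𝔥_{ρ₂}` dominates for large `y2`,
because every `α j < 1`, and a large multiple of the positive function `h_{ρ₁}` repairs the finitely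
many other `y2`.

Existence of `ρ₁`, `ρ₂` and the conjugate points is an intermediate value argument for the `k`-th
eigenvalue. Lower semicontinuity of eigenvalue counts in open sets, with a constant total count, is
the continuity needed. For small parameters Gershgorin discs put all eigenvalues above `1`; just
before parameter `1` the sign of the derivative of `det (I - A)` puts them all below. That
derivative is a positive multiple of a drift at `(1,1)`, and the assumed sum of minors at `(ρ₂,1)`.
Perron–Frobenius supplies the positive eigenvectors `d1`, `d2`. -/

open Filter Topology

/-! ### Real simple spectra under perturbation, and an intermediate value theorem for the `k`-th
eigenvalue. -/

section SimpleSpectrum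

variable {S : Type*} [Fintype S] [DecidableEq S]

/-- The finite set of real eigenvalues of a real matrix. -/
noncomputable def realEigs (M : Matrix S S ℝ) : Finset ℝ := M.charpoly.roots.toFinset

/-- The matrix has as many real eigenvalues as its size. -/
def SimpleSpectrum (M : Matrix S S ℝ) : Prop := (realEigs M).card = Fintype.card S

theorem mem_realEigs_iff_hasEigenvalue {M : Matrix S S ℝ} {x : ℝ} :
    x ∈ realEigs M ↔ Module.End.HasEigenvalue (Matrix.toLin' M) x := by
  rw [Module.End.hasEigenvalue_iff_isRoot_charpoly, Matrix.charpoly_toLin', realEigs,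
    Multiset.mem_toFinset, Polynomial.mem_roots M.charpoly_monic.ne_zero]

theorem mem_realEigs_iff_eval {M : Matrix S S ℝ} {x : ℝ} :
    x ∈ realEigs M ↔ M.charpoly.eval x = 0 := by
  rw [realEigs, Multiset.mem_toFinset, Polynomial.mem_roots M.charpoly_monic.ne_zero]
  rfl

theorem simpleSpectrum_iff_ncard {M : Matrix S S ℝ} :
    SimpleSpectrum M ↔
      {x : ℝ | Module.End.HasEigenvalue (Matrix.toLin' M) x}.ncard = Fintype.card S := by
  have : {x : ℝ | Module.End.HasEigenvalue (Matrix.toLin' M) x} = (realEigs M : Set ℝ) := by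
    ext x
    simp [mem_realEigs_iff_hasEigenvalue]
  rw [this, Set.ncard_coe_finset, SimpleSpectrum]

theorem isKthEigenvalue_iff {M : Matrix S S ℝ} {k : ℕ} {x : ℝ} :
    IsKthEigenvalue M k x ↔ x ∈ realEigs M ∧ ((realEigs M).filter (x < ·)).card = k := by
  have : {z : ℝ | Module.End.HasEigenvalue (Matrix.toLin' M) z ∧ x < z} =
      ((realEigs M).filter (x < ·) : Finset ℝ) := by
    ext z
    simp [mem_realEigs_iff_hasEigenvalue]
  rw [IsKthEigenvalue, this, Set.ncard_coe_finset, mem_realEigs_iff_hasEigenvalue]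

namespace SimpleSpectrum

variable {M : Matrix S S ℝ}

theorem roots_eq (h : SimpleSpectrum M) : M.charpoly.roots = (realEigs M).val := by
  have h1 : M.charpoly.roots.card ≤ Fintype.card S := by
    rw [← M.charpoly_natDegree_eq_dim]
    exact Polynomial.card_roots' _
  have h2 : M.charpoly.roots.toFinset.card ≤ M.charpoly.roots.card :=
    Multiset.toFinset_card_le _
  have h3 : M.charpoly.roots.toFinset.card = Fintype.card S := h
  have h4 : M.charpoly.roots.Nodup :=
    Multiset.toFinset_card_eq_card_iff_nodup.1 (by omega)
  rw [realEigs, Multiset.toFinset_val, h4.dedup]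

theorem charpoly_eval (h : SimpleSpectrum M) (x : ℝ) :
    M.charpoly.eval x = ∏ z ∈ realEigs M, (x - z) := by
  have h1 : M.charpoly.roots.card = M.charpoly.natDegree := by
    rw [h.roots_eq, M.charpoly_natDegree_eq_dim]
    exact h
  rw [← Polynomial.prod_multiset_X_sub_C_of_monic_of_roots_card_eq M.charpoly_monic h1,
    h.roots_eq]
  change (∏ z ∈ realEigs M, (Polynomial.X - Polynomial.C z)).eval x = _
  rw [Polynomial.eval_prod]
  simp

/-- Geometric multiplicity is at most algebraic multiplicity, which is at most one here, so every
eigenspace is at most a line. -/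
theorem exists_eq_smul (h : SimpleSpectrum M) {x : ℝ} {v w : S → ℝ} (hv : M.mulVec v = x • v)
    (hw : M.mulVec w = x • w) (hv0 : v ≠ 0) : ∃ c : ℝ, w = c • v := by
  have h1 := LinearMap.finrank_eigenspace_le (Matrix.toLin' M) x
  rw [Matrix.charpoly_toLin', ← Polynomial.count_roots, h.roots_eq] at h1
  have h2 := h1.trans (Multiset.nodup_iff_count_le_one.1 (realEigs M).nodup x)
  have hv' : v ∈ Module.End.eigenspace (Matrix.toLin' M) x := by
    rw [Module.End.mem_eigenspace_iff]
    simpa using hv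
  have hw' : w ∈ Module.End.eigenspace (Matrix.toLin' M) x := by
    rw [Module.End.mem_eigenspace_iff]
    simpa using hw
  obtain ⟨u, hu⟩ := finrank_le_one_iff.1 h2
  obtain ⟨a, ha⟩ := hu ⟨v, hv'⟩
  obtain ⟨b, hb⟩ := hu ⟨w, hw'⟩
  have ha' : a • (u : S → ℝ) = v := congrArg Subtype.val ha
  have hb' : b • (u : S → ℝ) = w := congrArg Subtype.val hb
  have ha0 : a ≠ 0 := by
    rintro rfl
    exact hv0 (by simpa using ha'.symm)
  refine ⟨b / a, ?_⟩
  rw [← ha', ← hb', smul_smul, div_mul_cancel₀ _ ha0]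

theorem transpose (h : SimpleSpectrum M) : SimpleSpectrum M.transpose := by
  rwa [SimpleSpectrum, realEigs, Matrix.charpoly_transpose]

theorem card_filter_le_add (h : SimpleSpectrum M) (x : ℝ) :
    ((realEigs M).filter (x ≤ ·)).card + ((realEigs M).filter (· ∈ Set.Iio x)).card =
      Fintype.card S := by
  rw [← h, ← Finset.card_filter_add_card_filter_not (s := realEigs M) (x ≤ ·)]
  simp [not_le]

end SimpleSpectrum

variable {A : ℝ → Matrix S S ℝ} {t₀ : ℝ}

theorem continuousAt_charpoly_eval (hA : ContinuousAt A t₀) (x : ℝ) :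
    ContinuousAt (fun t => (A t).charpoly.eval x) t₀ := by
  simp only [Matrix.eval_charpoly]
  have : Continuous fun M : Matrix S S ℝ => (Matrix.scalar S x - M).det :=
    (continuous_const.sub continuous_id).matrix_det
  exact this.continuousAt.comp hA

/-- Simple eigenvalues persist under small perturbations. -/
theorem SimpleSpectrum.eventually_exists_mem (h : SimpleSpectrum (A t₀)) (hA : ContinuousAt A t₀)
    {z : ℝ} (hz : z ∈ realEigs (A t₀)) {U : Set ℝ} (hU : U ∈ 𝓝 z) :
    ∀ᶠ t in 𝓝 t₀, ∃ w ∈ realEigs (A t), w ∈ U := by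
  set q : ℝ → ℝ := fun x => ∏ w ∈ (realEigs (A t₀)).erase z, (x - w)
  have hq : Continuous q := by fun_prop
  have hpq : ∀ x, (A t₀).charpoly.eval x = (x - z) * q x := fun x => by
    rw [h.charpoly_eval, Finset.mul_prod_erase _ (fun w => x - w) hz]
  have hqz : q z ≠ 0 := Finset.prod_ne_zero_iff.2 fun w hw =>
    sub_ne_zero.2 (Finset.ne_of_mem_erase hw).symm
  -- Since `z` is a simple root, `q` keeps its sign near `z` while `x - z` changes sign. The
  -- resulting sign change between `z - ε` and `z + ε` survives small perturbations and traps a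
  -- root.
  have h1 : ∀ᶠ ε in 𝓝 (0 : ℝ), 0 < q (z - ε) * q (z + ε) := by
    have hc : Continuous fun ε : ℝ => q (z - ε) * q (z + ε) := by fun_prop
    refine continuousAt_const.eventually_lt hc.continuousAt ?_
    simpa using mul_self_pos.2 hqz
  obtain ⟨r, hr, hrU⟩ := Metric.mem_nhds_iff.1 hU
  have h2 : ∀ᶠ ε in 𝓝 (0 : ℝ), ε < r := eventually_lt_nhds hr
  obtain ⟨ε, ⟨h3, h4⟩, h5⟩ :=
    (((h1.and h2).filter_mono nhdsWithin_le_nhds).and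
      (self_mem_nhdsWithin : Set.Ioi (0 : ℝ) ∈ 𝓝[>] 0)).exists
  have h5 : 0 < ε := h5
  have h6 : (A t₀).charpoly.eval (z - ε) * (A t₀).charpoly.eval (z + ε) < 0 := by
    rw [hpq, hpq]
    nlinarith [mul_pos (mul_pos h5 h5) h3]
  have h7 : ∀ᶠ t in 𝓝 t₀, (A t).charpoly.eval (z - ε) * (A t).charpoly.eval (z + ε) < 0 :=
    ((continuousAt_charpoly_eval hA _).mul (continuousAt_charpoly_eval hA _)).eventually_lt
      continuousAt_const h6
  filter_upwards [h7] with t ht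
  have h8 := intermediate_value_uIcc (a := z - ε) (b := z + ε)
    (f := fun x => (A t).charpoly.eval x) (A t).charpoly.continuous.continuousOn
  have h9 : (0 : ℝ) ∈ Set.uIcc ((A t).charpoly.eval (z - ε)) ((A t).charpoly.eval (z + ε)) := by
    rcases mul_neg_iff.1 ht with h | h
    · exact Set.mem_uIcc.2 (Or.inr ⟨h.2.le, h.1.le⟩)
    · exact Set.mem_uIcc.2 (Or.inl ⟨h.1.le, h.2.le⟩)
  obtain ⟨w, hw, hw0⟩ := h8 h9
  refine ⟨w, mem_realEigs_iff_eval.2 hw0, hrU ?_⟩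
  rw [Set.uIcc_of_le (by linarith)] at hw
  rw [Metric.mem_ball, Real.dist_eq, abs_lt]
  constructor <;> linarith [hw.1, hw.2]

open Classical in
/-- The number of eigenvalues in an open set is lower semicontinuous. -/
theorem SimpleSpectrum.eventually_card_le (h : SimpleSpectrum (A t₀)) (hA : ContinuousAt A t₀)
    {V : Set ℝ} (hV : IsOpen V) :
    ∀ᶠ t in 𝓝 t₀, ((realEigs (A t₀)).filter (· ∈ V)).card ≤
      ((realEigs (A t)).filter (· ∈ V)).card := by
  -- Disjoint neighbourhoods of the old eigenvalues make the choice of nearby new ones injective.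
  obtain ⟨U, hU, hdisj⟩ := (realEigs (A t₀)).finite_toSet.t2_separation
  have h1 : ∀ᶠ t in 𝓝 t₀, ∀ z ∈ (realEigs (A t₀)).filter (· ∈ V),
      ∃ w ∈ realEigs (A t), w ∈ U z ∩ V := by
    refine (Finset.eventually_all _).2 fun z hz => ?_
    rw [Finset.mem_filter] at hz
    exact h.eventually_exists_mem hA hz.1
      (((hU z).2.inter hV).mem_nhds ⟨(hU z).1, hz.2⟩)
  filter_upwards [h1] with t ht
  choose! f hf1 hf2 using ht
  refine Finset.card_le_card_of_injOn f (fun z hz => ?_) fun z hz w hw hzw => ?_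
  · exact Finset.mem_coe.2 (Finset.mem_filter.2 ⟨hf1 z hz, (hf2 z hz).2⟩)
  · by_contra hne
    have := hdisj (Finset.mem_filter.1 hz).1 (Finset.mem_filter.1 hw).1 hne
    refine Set.disjoint_left.1 this (hf2 z hz).1 ?_
    rw [hzw]
    exact (hf2 w hw).1

theorem SimpleSpectrum.eventually_card_lt_ge (h : SimpleSpectrum (A t₀)) (hA : ContinuousAt A t₀)
    (x : ℝ) : ∀ᶠ t in 𝓝 t₀, ((realEigs (A t₀)).filter (x < ·)).card ≤
      ((realEigs (A t)).filter (x < ·)).card := by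
  filter_upwards [h.eventually_card_le hA (isOpen_Ioi (a := x))] with t ht
  simpa using ht

/-- Pass to complements: the count below `x` can only grow under perturbation and the total is
fixed, so the count at or above `x` can only drop. -/
theorem SimpleSpectrum.eventually_card_le_le (h : SimpleSpectrum (A t₀)) (hA : ContinuousAt A t₀)
    (hs : ∀ᶠ t in 𝓝 t₀, SimpleSpectrum (A t)) (x : ℝ) :
    ∀ᶠ t in 𝓝 t₀, ((realEigs (A t)).filter (x ≤ ·)).card ≤
      ((realEigs (A t₀)).filter (x ≤ ·)).card := by
  filter_upwards [h.eventually_card_le hA (isOpen_Iio (a := x)), hs] with t ht hst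
  have h1 := h.card_filter_le_add x
  have h2 := hst.card_filter_le_add x
  simp only [Set.mem_Iio] at ht h1 h2
  omega

theorem card_filter_le_le_succ (M : Matrix S S ℝ) (x : ℝ) :
    ((realEigs M).filter (x ≤ ·)).card ≤ ((realEigs M).filter (x < ·)).card + 1 := by
  refine (Finset.card_le_card (t := insert x ((realEigs M).filter (x < ·))) ?_).trans
    (Finset.card_insert_le _ _)
  intro z hz
  rw [Finset.mem_filter] at hz
  rcases hz.2.eq_or_lt with h | h
  · simp [h]
  · simp [hz.1, h]

/-- Intermediate value theorem for the `k`-th eigenvalue. -/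
theorem exists_isKthEigenvalue {a b : ℝ} (hab : a ≤ b)
    (hA : ∀ t, 0 < t → ContinuousAt A t) (hs : ∀ t, 0 < t → SimpleSpectrum (A t))
    (ha0 : 0 < a) {k : ℕ} {x : ℝ} (ha : k < ((realEigs (A a)).filter (x < ·)).card)
    (hb : ((realEigs (A b)).filter (x ≤ ·)).card ≤ k) :
    ∃ t ∈ Set.Icc a b, IsKthEigenvalue (A t) k x := by
  have hs' : ∀ t, 0 < t → ∀ᶠ s in 𝓝 t, SimpleSpectrum (A s) := fun t ht =>
    (eventually_gt_nhds ht).mono hs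
  by_contra! hcon
  have hle : ∀ t, ((realEigs (A t)).filter (x < ·)).card ≤
      ((realEigs (A t)).filter (x ≤ ·)).card := fun t =>
    Finset.card_le_card (Finset.monotone_filter_right _ fun _ _ h => le_of_lt h)
  have hU : ∀ t, 0 < t → k < ((realEigs (A t)).filter (x < ·)).card →
      ∀ᶠ s in 𝓝 t, k < ((realEigs (A s)).filter (x < ·)).card := fun t ht h =>
    ((hs t ht).eventually_card_lt_ge (hA t ht) x).mono fun s hs => h.trans_le hs
  have hV : ∀ t, 0 < t → ((realEigs (A t)).filter (x ≤ ·)).card ≤ k →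
      ∀ᶠ s in 𝓝 t, ((realEigs (A s)).filter (x ≤ ·)).card ≤ k := fun t ht h =>
    ((hs t ht).eventually_card_le_le (hA t ht) (hs' t ht) x).mono fun s hs => hs.trans h
  -- The two open sets are disjoint, one contains `a` and the other `b`. A parameter in neither has
  -- at most `k` eigenvalues above `x` but more than `k` at or above it; then `x` is an eigenvalue
  -- with exactly `k` above it, so otherwise the sets would disconnect the interval.
  obtain ⟨t, -, ht1, ht2⟩ := isPreconnected_Icc (a := a) (b := b)
    {t | ∀ᶠ s in 𝓝 t, k < ((realEigs (A s)).filter (x < ·)).card}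
    {t | ∀ᶠ s in 𝓝 t, ((realEigs (A s)).filter (x ≤ ·)).card ≤ k}
    isOpen_setOfPred_eventually_nhds isOpen_setOfPred_eventually_nhds
    (fun t ht => by
      have ht0 : 0 < t := ha0.trans_le ht.1
      by_cases h1 : k < ((realEigs (A t)).filter (x < ·)).card
      · exact Or.inl (hU t ht0 h1)
      by_cases h2 : ((realEigs (A t)).filter (x ≤ ·)).card ≤ k
      · exact Or.inr (hV t ht0 h2)
      refine absurd (isKthEigenvalue_iff.2 ⟨?_, ?_⟩) (hcon t ht)
      · by_contra hx
        have : (realEigs (A t)).filter (x ≤ ·) = (realEigs (A t)).filter (x < ·) := by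
          refine Finset.filter_congr fun z hz => ⟨fun h => lt_of_le_of_ne h ?_, le_of_lt⟩
          rintro rfl
          exact hx hz
        rw [this] at h2
        omega
      · have := card_filter_le_le_succ (A t) x
        omega)
    ⟨a, Set.left_mem_Icc.2 hab, hU a ha0 ha⟩
    ⟨b, Set.right_mem_Icc.2 hab, hV b (ha0.trans_le hab) hb⟩
  have h1 := ht1.self_of_nhds
  have h2 := ht2.self_of_nhds
  have h3 := hle t
  omega

end SimpleSpectrum

/-! ### Derivatives of determinants and principal minors. -/

section DetDeriv

variable {S : Type*} [Fintype S] [DecidableEq S]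

/-- In the Leibniz expansion, the terms whose factor from column `j` is differentiated add up to the
determinant with column `j` replaced by its derivative. -/
theorem hasDerivAt_det {N : ℝ → Matrix S S ℝ} {N' : Matrix S S ℝ} {t₀ : ℝ}
    (h : ∀ i j, HasDerivAt (fun t => N t i j) (N' i j) t₀) :
    HasDerivAt (fun t => (N t).det)
      (∑ j, ((N t₀).updateCol j (fun i => N' i j)).det) t₀ := by
  have h1 : HasDerivAt (fun t => ∑ σ : Equiv.Perm S, (Equiv.Perm.sign σ : ℝ) * ∏ i, N t (σ i) i)
      (∑ σ : Equiv.Perm S, (Equiv.Perm.sign σ : ℝ) *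
        ∑ j, (∏ i ∈ Finset.univ.erase j, N t₀ (σ i) i) * N' (σ j) j) t₀ := by
    refine HasDerivAt.fun_sum fun σ _ => ?_
    refine HasDerivAt.const_mul _ ?_
    have := HasDerivAt.fun_finsetProd (u := Finset.univ) (x := t₀)
      (f := fun i t => N t (σ i) i) (f' := fun i => N' (σ i) i) fun i _ => h _ _
    simpa using this
  simp only [Matrix.det_apply']
  convert! h1 using 1
  simp only [Finset.mul_sum]
  rw [Finset.sum_comm]
  refine Finset.sum_congr rfl fun σ _ => Finset.sum_congr rfl fun j _ => ?_
  congr 1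
  rw [← Finset.mul_prod_erase _ _ (Finset.mem_univ j), mul_comm]
  congr 1
  · refine Finset.prod_congr rfl fun i hi => ?_
    rw [Matrix.updateCol_ne (Finset.ne_of_mem_erase hi)]
  · rw [Matrix.updateCol_self]

/-- Derivative of a determinant of which only the diagonal varies. -/
theorem hasDerivAt_det_of_diag {N : ℝ → Matrix S S ℝ} {d : S → ℝ} {t₀ : ℝ}
    (hdiag : ∀ i, HasDerivAt (fun t => N t i i) (d i) t₀)
    (hoff : ∀ i j, i ≠ j → ∀ t, N t i j = N t₀ i j) :
    HasDerivAt (fun t => (N t).det) (∑ j, d j * (N t₀).adjugate j j) t₀ := by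
  have h := hasDerivAt_det (N := N) (N' := Matrix.diagonal d) (t₀ := t₀) fun i j => by
    rcases eq_or_ne i j with rfl | hij
    · simpa using hdiag i
    · rw [Matrix.diagonal_apply_ne _ hij]
      simp only [hoff i j hij]
      exact hasDerivAt_const _ _
  convert! h using 1
  refine Finset.sum_congr rfl fun j _ => ?_
  have : (fun i => Matrix.diagonal d i j) = d j • (Pi.single j 1 : S → ℝ) := by
    ext i
    rcases eq_or_ne i j with rfl | hij
    · simp
    · simp [hij]
  rw [this, Matrix.det_updateCol_smul, Matrix.adjugate_apply,
    ← Matrix.cramer_apply, ← Matrix.cramer_transpose_apply, Matrix.cramer_eq_adjugate_mulVec, Matrix.cramer_eq_adjugate_mulVec]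
  simp [← Matrix.adjugate_transpose]

/-- With row `m` replaced by a unit vector the matrix is block triangular with a block `1` at `m`.
This identifies the minors of `ConjCondition` with the cofactors in the derivative formula. -/
theorem adjugate_apply_self (N : Matrix S S ℝ) (m : S) :
    N.adjugate m m = (N.submatrix (Subtype.val : {i // i ≠ m} → S)
      (Subtype.val : {i // i ≠ m} → S)).det := by
  rw [Matrix.adjugate_apply, Matrix.twoBlockTriangular_det _ (fun i => i ≠ m)]
  · have h1 : ((N.updateRow m (Pi.single m 1)).toSquareBlockProp fun i => ¬ i ≠ m).det = 1 := by
      have : ((N.updateRow m (Pi.single m 1)).toSquareBlockProp fun i => ¬ i ≠ m) = 1 := by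
        ext ⟨i, hi⟩ ⟨j, hj⟩
        obtain rfl : i = m := not_not.1 hi
        obtain rfl : j = i := not_not.1 hj
        simp [Matrix.toSquareBlockProp]
      rw [this, Matrix.det_one]
    rw [h1, mul_one]
    congr 1
    ext ⟨i, hi⟩ ⟨j, hj⟩
    simp [Matrix.toSquareBlockProp, Matrix.updateRow_ne hi]
  · intro i hi j hj
    obtain rfl : i = m := not_not.1 hi
    simp [hj]

end DetDeriv

/-! ### Parameters at which `1` is the `k`-th eigenvalue. -/

section Level

variable {S : Type*} [Fintype S] [DecidableEq S]

theorem charpoly_eval_one (M : Matrix S S ℝ) : M.charpoly.eval 1 = (1 - M).det := by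
  rw [Matrix.eval_charpoly, map_one]

/-- If at most one eigenvalue is at least `x` and the characteristic polynomial is positive at `x`,
then all eigenvalues are smaller than `x`. -/
theorem SimpleSpectrum.filter_le_eq_empty {M : Matrix S S ℝ} (h : SimpleSpectrum M) {x : ℝ}
    (hc : ((realEigs M).filter (x ≤ ·)).card ≤ 1) (hpos : 0 < M.charpoly.eval x) :
    (realEigs M).filter (x ≤ ·) = ∅ := by
  by_contra hne
  obtain ⟨w, hw⟩ := Finset.nonempty_iff_ne_empty.2 hne
  have hw' := Finset.mem_filter.1 hw
  rw [h.charpoly_eval, ← Finset.mul_prod_erase _ _ hw'.1] at hpos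
  have h1 : 0 ≤ ∏ z ∈ (realEigs M).erase w, (x - z) := by
    refine Finset.prod_nonneg fun z hz => ?_
    rw [Finset.mem_erase] at hz
    by_contra! hzx
    exact hz.1 (Finset.card_le_one.1 hc z
      (Finset.mem_filter.2 ⟨hz.2, by linarith⟩) w hw)
  nlinarith [hw'.2]

theorem IsKthEigenvalue.card_filter_le {M : Matrix S S ℝ} {k : ℕ} {x : ℝ}
    (h : IsKthEigenvalue M k x) : ((realEigs M).filter (x ≤ ·)).card ≤ k + 1 := by
  rw [isKthEigenvalue_iff] at h
  exact h.2 ▸ card_filter_le_le_succ M x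

theorem card_filter_lt_of_forall {M : Matrix S S ℝ} (h : SimpleSpectrum M) {x : ℝ}
    (hx : ∀ z ∈ realEigs M, x < z) :
    ((realEigs M).filter (x < ·)).card = Fintype.card S := by
  rw [Finset.filter_true_of_mem hx]
  exact h

/-- A second parameter for which `1` is the largest eigenvalue, found from the sign of the
derivative of the determinant at the first. -/
theorem exists_isKthEigenvalue_zero [Nonempty S] {A : ℝ → Matrix S S ℝ}
    (hA : ∀ t, 0 < t → ContinuousAt A t) (hs : ∀ t, 0 < t → SimpleSpectrum (A t))
    (htop : IsKthEigenvalue (A 1) 0 1) {g' : ℝ}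
    (hder : HasDerivAt (fun t => (1 - A t).det) g' 1) (hneg : g' < 0)
    (hsmall : ∀ᶠ t in 𝓝[>] (0 : ℝ), ∀ z ∈ realEigs (A t), 1 < z) :
    ∃ t ∈ Set.Ioo (0 : ℝ) 1, IsKthEigenvalue (A t) 0 1 := by
  have hg1 : (1 - A 1).det = 0 := by
    rw [← charpoly_eval_one]
    exact mem_realEigs_iff_eval.1 (isKthEigenvalue_iff.1 htop).1
  -- The determinant vanishes at `1` with negative slope, hence is positive just to the left. As at
  -- most one eigenvalue is `≥ 1` there, positivity excludes even that one.
  have hpos : ∀ᶠ t in 𝓝[<] (1 : ℝ), 0 < (1 - A t).det := by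
    have h1 := (hasDerivAt_iff_tendsto_slope.1 hder).eventually_lt_const hneg
    have h2 : 𝓝[<] (1 : ℝ) ≤ 𝓝[≠] 1 := nhdsWithin_mono _ fun t ht => ne_of_lt ht
    filter_upwards [h1.filter_mono h2, self_mem_nhdsWithin] with t ht ht1
    rw [slope_def_field, hg1, sub_zero] at ht
    have ht1 : t - 1 < 0 := sub_neg.2 ht1
    by_contra! hcon
    exact absurd ht (not_lt.2 (div_nonneg_of_nonpos hcon ht1.le))
  have hle : ∀ᶠ t in 𝓝[<] (1 : ℝ), ((realEigs (A t)).filter (1 ≤ ·)).card ≤ 1 := by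
    refine Eventually.filter_mono nhdsWithin_le_nhds ?_
    filter_upwards [(hs 1 one_pos).eventually_card_le_le (hA 1 one_pos)
      ((eventually_gt_nhds one_pos).mono hs) 1] with t ht
    exact ht.trans htop.card_filter_le
  have hIoo : ∀ᶠ t in 𝓝[<] (1 : ℝ), t ∈ Set.Ioo (0 : ℝ) 1 := Ioo_mem_nhdsLT one_pos
  obtain ⟨b, ⟨hb1, hb2⟩, hb3⟩ := ((hpos.and hle).and hIoo).exists
  have hb : (realEigs (A b)).filter (1 ≤ ·) = ∅ :=
    (hs b hb3.1).filter_le_eq_empty hb2 (by rwa [charpoly_eval_one])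
  have hIoo' : ∀ᶠ t in 𝓝[>] (0 : ℝ), t ∈ Set.Ioo (0 : ℝ) b := Ioo_mem_nhdsGT hb3.1
  obtain ⟨a, ha1, ha2⟩ := (hsmall.and hIoo').exists
  obtain ⟨t, ht, htk⟩ := exists_isKthEigenvalue (k := 0) (x := 1) ha2.2.le hA hs ha2.1
    (by rw [card_filter_lt_of_forall (hs a ha2.1) ha1]; exact Fintype.card_pos)
    (by rw [hb]; simp)
  exact ⟨t, ⟨ha2.1.trans_le ht.1, ht.2.trans_lt hb3.2⟩, htk⟩

/-- From a parameter at which `1` is the largest eigenvalue, the smaller parameters at which `1` is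
the `k`-th eigenvalue. -/
theorem exists_isKthEigenvalue_lt {A : ℝ → Matrix S S ℝ}
    (hA : ∀ t, 0 < t → ContinuousAt A t) (hs : ∀ t, 0 < t → SimpleSpectrum (A t))
    {b : ℝ} (hb : 0 < b) (htop : IsKthEigenvalue (A b) 0 1)
    (hsmall : ∀ᶠ t in 𝓝[>] (0 : ℝ), ∀ z ∈ realEigs (A t), 1 < z)
    {k : ℕ} (hk0 : k ≠ 0) (hk : k < Fintype.card S) :
    ∃ t ∈ Set.Ioo 0 b, IsKthEigenvalue (A t) k 1 := by
  have hIoo' : ∀ᶠ t in 𝓝[>] (0 : ℝ), t ∈ Set.Ioo (0 : ℝ) b := Ioo_mem_nhdsGT hb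
  obtain ⟨a, ha1, ha2⟩ := (hsmall.and hIoo').exists
  obtain ⟨t, ht, htk⟩ := exists_isKthEigenvalue (k := k) (x := 1) ha2.2.le hA hs ha2.1
    (by rwa [card_filter_lt_of_forall (hs a ha2.1) ha1])
    -- At `b` at most one eigenvalue is `≥ 1`, and `1 ≤ k`.
    (htop.card_filter_le.trans (by omega))
  refine ⟨t, ⟨ha2.1.trans_le ht.1, lt_of_le_of_ne ht.2 ?_⟩, htk⟩
  rintro rfl
  exact hk0 (htk.2.symm.trans htop.2)

end Level

/-! ### Stochastic matrices: top eigenvalue and cofactors. -/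

section Stochastic

variable {S : Type*} [Fintype S] [DecidableEq S]

/-- Eigenvalues of a stochastic matrix are at most `1`. -/
theorem le_one_of_mem_realEigs {M : Matrix S S ℝ} (h0 : ∀ i j, 0 ≤ M i j)
    (h1 : ∀ i, ∑ j, M i j = 1) {z : ℝ} (hz : z ∈ realEigs M) : z ≤ 1 := by
  -- The Gershgorin disc of row `k` reaches to the right exactly as far as the row sum, which is
  -- `1`.
  obtain ⟨k, hk⟩ := eigenvalue_mem_ball (mem_realEigs_iff_hasEigenvalue.1 hz)
  rw [Metric.mem_closedBall, Real.dist_eq] at hk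
  have h2 := (abs_le.1 hk).2
  simp only [Real.norm_of_nonneg (h0 _ _)] at h2
  have h3 := h1 k
  rw [← Finset.add_sum_erase _ _ (Finset.mem_univ k)] at h3
  linarith

omit [DecidableEq S] in
theorem stochastic_mulVec_one {M : Matrix S S ℝ} (h1 : ∀ i, ∑ j, M i j = 1) :
    M.mulVec 1 = (1 : ℝ) • 1 := by
  ext i
  simp [Matrix.mulVec, dotProduct, h1]

theorem isKthEigenvalue_zero_of_stochastic [Nonempty S] {M : Matrix S S ℝ}
    (h0 : ∀ i j, 0 ≤ M i j) (h1 : ∀ i, ∑ j, M i j = 1) : IsKthEigenvalue M 0 1 := by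
  rw [isKthEigenvalue_iff]
  refine ⟨mem_realEigs_iff_hasEigenvalue.2 ?_, ?_⟩
  · refine Module.End.hasEigenvalue_of_hasEigenvector (x := (1 : S → ℝ)) ⟨?_, one_ne_zero⟩
    rw [Module.End.mem_eigenspace_iff]
    simpa using stochastic_mulVec_one h1
  · rw [Finset.card_eq_zero, Finset.filter_eq_empty_iff]
    intro z hz
    exact not_lt.2 (le_one_of_mem_realEigs h0 h1 hz)

/-- Both sides of the computation are the derivative of the characteristic polynomial at `1`: the
trace of the adjugate equals the product of `1 - w` over the other eigenvalues `w`, all smaller than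
`1`. -/
theorem sum_adjugate_pos {M : Matrix S S ℝ} (hs : SimpleSpectrum M)
    (htop : IsKthEigenvalue M 0 1) : 0 < ∑ m, (1 - M).adjugate m m := by
  rw [isKthEigenvalue_iff, Finset.card_eq_zero, Finset.filter_eq_empty_iff] at htop
  have h1 : HasDerivAt (fun x : ℝ => (x • (1 : Matrix S S ℝ) - M).det)
      (∑ m, (1 : ℝ) * ((1 : ℝ) • (1 : Matrix S S ℝ) - M).adjugate m m) 1 := by
    refine hasDerivAt_det_of_diag (N := fun x : ℝ => x • (1 : Matrix S S ℝ) - M)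
      (d := fun _ => 1) (fun i => ?_) fun i j hij t => ?_
    · simpa using (hasDerivAt_id (1 : ℝ)).sub_const (M i i)
    · simp [hij]
  set q : ℝ → ℝ := fun x => ∏ w ∈ (realEigs M).erase 1, (x - w)
  have hq : Continuous q := by fun_prop
  have hpq : (fun x : ℝ => (x • (1 : Matrix S S ℝ) - M).det) = fun x => (x - 1) * q x := by
    ext x
    rw [Finset.mul_prod_erase _ (fun w => x - w) htop.1, ← hs.charpoly_eval,
      Matrix.eval_charpoly]
    congr 2
    ext i j
    simp [Matrix.diagonal_apply, Matrix.one_apply]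
  rw [hpq, hasDerivAt_iff_tendsto_slope] at h1
  have h2 : Tendsto (slope (fun x => (x - 1) * q x) 1) (𝓝[≠] 1) (𝓝 (q 1)) := by
    refine (hq.continuousAt.tendsto.mono_left nhdsWithin_le_nhds).congr' ?_
    filter_upwards [self_mem_nhdsWithin] with x hx
    rw [slope_def_field, sub_self, zero_mul, sub_zero, mul_div_cancel_left₀]
    exact sub_ne_zero.2 hx
  have h3 := tendsto_nhds_unique h1 h2
  simp only [one_mul, one_smul] at h3
  rw [h3]
  refine Finset.prod_pos fun w hw => ?_
  rw [Finset.mem_erase] at hw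
  have := lt_of_le_of_ne (not_lt.1 (htop.2 hw.2)) hw.1
  linarith

/-- The principal cofactors of `1 - M`, for `M` stochastic, are positively proportional to the
stationary distribution. -/
theorem exists_adjugate_eq_mul_stationary [Nonempty S] {M : Matrix S S ℝ}
    (hs : SimpleSpectrum M) (h0 : ∀ i j, 0 ≤ M i j) (h1 : ∀ i, ∑ j, M i j = 1)
    {π : S → ℝ} (hπ : ∑ m, π m = 1) (hπM : Matrix.vecMul π M = π) :
    ∃ c : ℝ, 0 < c ∧ ∀ m, (1 - M).adjugate m m = c * π m := by
  have htop := isKthEigenvalue_zero_of_stochastic h0 h1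
  have hdet : (1 - M).det = 0 := by
    rw [← charpoly_eval_one]
    exact mem_realEigs_iff_eval.1 (isKthEigenvalue_iff.1 htop).1
  set B := (1 - M).adjugate with hB
  -- Because the determinant vanishes, columns of the adjugate are right eigenvectors, hence
  -- constant, and rows are left eigenvectors, hence multiples of `π`. Positivity of the factor
  -- comes from the trace.
  have hMB : M * B = B := by
    have := Matrix.mul_adjugate (1 - M)
    rw [hdet, zero_smul, sub_mul, one_mul, sub_eq_zero] at this
    exact this.symm
  have hBM : B * M = B := by
    have := Matrix.adjugate_mul (1 - M)
    rw [hdet, zero_smul, mul_sub, mul_one, sub_eq_zero] at this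
    exact this.symm
  have hcol : ∀ m m' n, B m n = B m' n := fun m m' n => by
    obtain ⟨c, hc⟩ := hs.exists_eq_smul (stochastic_mulVec_one h1)
      (w := fun i => B i n) (x := 1) (by
        ext i
        simpa [Matrix.mul_apply, Matrix.mulVec, dotProduct] using congrFun (congrFun hMB i) n)
      one_ne_zero
    have h2 := congrFun hc m
    have h3 := congrFun hc m'
    simp only [Pi.smul_apply, Pi.one_apply] at h2 h3
    rw [h2, h3]
  obtain ⟨m₀⟩ := ‹Nonempty S›
  have hπ0 : π ≠ 0 := by
    rintro rfl
    simp at hπ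
  obtain ⟨c, hc⟩ := hs.transpose.exists_eq_smul (v := π) (w := B m₀) (x := 1)
    (by rw [Matrix.mulVec_transpose, hπM, one_smul])
    (by
      rw [Matrix.mulVec_transpose, one_smul]
      ext j
      simpa [Matrix.mul_apply, Matrix.vecMul, dotProduct] using congrFun (congrFun hBM m₀) j)
    hπ0
  have hBc : ∀ m, B m m = c * π m := fun m => by
    rw [hcol m m₀ m, hc]
    rfl
  refine ⟨c, ?_, hBc⟩
  have := sum_adjugate_pos hs htop
  rw [← hB] at this
  simpa only [hBc, ← Finset.mul_sum, hπ, mul_one] using this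

end Stochastic

/-! ### Existence of `ρ₁`, `ρ₂` and the conjugate points. -/

namespace ModulatedTandem

variable {S : Type*} [Fintype S] [DecidableEq S] (W : ModulatedTandem S)

theorem charMat_diag (β α : ℝ) (m : S) : W.charMat β α m m =
    W.P m m * (W.lam m * (1 / β) + W.mu1 m * α + W.mu2 m * (β / α)) := by
  simp [charMat]

theorem charMat_off (β α : ℝ) {m n : S} (h : m ≠ n) : W.charMat β α m n = W.P m n := by
  simp [charMat, h]

theorem charMat_one : W.charMat 1 1 = W.P := by
  ext m n
  rcases eq_or_ne m n with rfl | h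
  · rw [charMat_diag]
    have := W.rate_sum m
    simp [this]
  · exact W.charMat_off _ _ h

/-- On the diagonal `μ₂ β/α = μ₂`, so the single equation for `A` yields both level conditions on
`ρ₁`. -/
theorem charMat_self (r : ℝ) (hr : r ≠ 0) : W.charMat2 r r = W.charMat r r := by
  ext m n
  simp [charMat, charMat2, hr]

theorem charMat_simple (hs : W.SimpleEigenvalues) {β α : ℝ} (hβ : 0 < β) (hα : 0 < α) :
    SimpleSpectrum (W.charMat β α) :=
  simpleSpectrum_iff_ncard.2 (hs β α hβ hα)

theorem continuousAt_charMat {f g : ℝ → ℝ} {t : ℝ} (hf : ContinuousAt f t)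
    (hg : ContinuousAt g t) (hf0 : f t ≠ 0) (hg0 : g t ≠ 0) :
    ContinuousAt (fun t => W.charMat (f t) (g t)) t := by
  refine continuousAt_pi.2 fun m => continuousAt_pi.2 fun n => ?_
  rcases eq_or_ne m n with rfl | h
  · simp only [charMat_diag]
    fun_prop (disch := assumption)
  · simp only [W.charMat_off _ _ h]
    exact continuousAt_const

theorem sum_erase_P_lt (m : S) : ∑ n ∈ Finset.univ.erase m, W.P m n < 1 := by
  have h := W.P_sum m
  rw [← Finset.add_sum_erase _ _ (Finset.mem_univ m)] at h
  linarith [W.P_diag_pos m]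

/-- Off-diagonal row sums are below `1`, so a diagonal above `2` pushes every Gershgorin disc to the
right of `1`. -/
theorem one_lt_of_mem_realEigs {β α : ℝ} (h : ∀ m, 2 < W.charMat β α m m) :
    ∀ z ∈ realEigs (W.charMat β α), 1 < z := by
  intro z hz
  obtain ⟨k, hk⟩ := eigenvalue_mem_ball (mem_realEigs_iff_hasEigenvalue.1 hz)
  rw [Metric.mem_closedBall, Real.dist_eq] at hk
  have h1 : ∑ n ∈ Finset.univ.erase k, ‖W.charMat β α k n‖ =
      ∑ n ∈ Finset.univ.erase k, W.P k n := by
    refine Finset.sum_congr rfl fun n hn => ?_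
    rw [W.charMat_off _ _ (Finset.ne_of_mem_erase hn).symm, Real.norm_of_nonneg (W.P_nonneg _ _)]
  rw [h1] at hk
  linarith [(abs_le.1 hk).1, h k, W.sum_erase_P_lt k]

theorem eventually_lt_div {c : ℝ} (hc : 0 < c) (K : ℝ) :
    ∀ᶠ t in 𝓝[>] (0 : ℝ), K < c * (1 / t) := by
  simp only [one_div]
  exact (tendsto_inv_nhdsGT_zero.const_mul_atTop hc).eventually_gt_atTop K

/-- The term `λ/β` blows up on the whole diagonal as `β → 0`; for `α → 0` at fixed `β` the term `μ₂
β/α` plays this role. -/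
theorem eventually_one_lt_of_lam {α : ℝ → ℝ} (hα : ∀ t, 0 < t → 0 < α t) :
    ∀ᶠ t in 𝓝[>] (0 : ℝ), ∀ z ∈ realEigs (W.charMat t (α t)), 1 < z := by
  have h : ∀ᶠ t in 𝓝[>] (0 : ℝ), ∀ m, 2 < W.P m m * W.lam m * (1 / t) :=
    eventually_all.2 fun m => eventually_lt_div (mul_pos (W.P_diag_pos m) (W.lam_pos m)) 2
  filter_upwards [h, self_mem_nhdsWithin] with t ht ht0
  refine W.one_lt_of_mem_realEigs fun m => (ht m).trans_le ?_
  have ht0 : 0 < t := ht0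
  have hαt := hα t ht0
  have h1 := W.P_diag_pos m
  have h2 := W.mu1_nonneg m
  have h3 := W.mu2_pos m
  rw [charMat_diag, mul_assoc]
  gcongr
  have h4 : 0 ≤ W.mu1 m * α t := by positivity
  have h5 : 0 ≤ W.mu2 m * (t / α t) := by positivity
  linarith

theorem eventually_one_lt_of_mu2 {β : ℝ} (hβ : 0 < β) :
    ∀ᶠ t in 𝓝[>] (0 : ℝ), ∀ z ∈ realEigs (W.charMat β t), 1 < z := by
  have h : ∀ᶠ t in 𝓝[>] (0 : ℝ), ∀ m, 2 < W.P m m * W.mu2 m * β * (1 / t) :=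
    eventually_all.2 fun m =>
      eventually_lt_div (mul_pos (mul_pos (W.P_diag_pos m) (W.mu2_pos m)) hβ) 2
  filter_upwards [h, self_mem_nhdsWithin] with t ht ht0
  refine W.one_lt_of_mem_realEigs fun m => (ht m).trans_le ?_
  have ht0 : 0 < t := ht0
  have h1 := W.P_diag_pos m
  have h2 := W.mu1_nonneg m
  have h3 := W.lam_pos m
  rw [charMat_diag, mul_assoc, mul_assoc, mul_one_div]
  gcongr
  have h4 : 0 ≤ W.mu1 m * t := by positivity
  have h5 : 0 ≤ W.lam m * (1 / β) := by positivity
  linarith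

/-- Derivative of `det (I - A)` along a curve, in terms of the derivatives of the diagonal. -/
theorem hasDerivAt_det_charMat {f g : ℝ → ℝ} {D : S → ℝ} {t : ℝ}
    (h : ∀ m, HasDerivAt (fun t => W.lam m * (1 / f t) + W.mu1 m * g t + W.mu2 m * (f t / g t))
      (D m) t) :
    HasDerivAt (fun t => (1 - W.charMat (f t) (g t)).det)
      (∑ m, -(W.P m m * D m) * (1 - W.charMat (f t) (g t)).adjugate m m) t := by
  refine hasDerivAt_det_of_diag (N := fun t => 1 - W.charMat (f t) (g t))
    (fun m => ?_) fun i j hij s => ?_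
  · simp only [Matrix.sub_apply, charMat_diag]
    exact ((h m).const_mul (W.P m m)).const_sub _
  · simp [W.charMat_off _ _ hij]

variable {W}

theorem exists_adjugate_eq [Nonempty S] (hs : W.SimpleEigenvalues) {π : S → ℝ}
    (hπ : ∑ m, π m = 1) (hπP : Matrix.vecMul π W.P = π) :
    ∃ c : ℝ, 0 < c ∧ ∀ m, (1 - W.charMat 1 1).adjugate m m = c * π m := by
  rw [charMat_one]
  refine exists_adjugate_eq_mul_stationary ?_ W.P_nonneg W.P_sum hπ hπP
  rw [← charMat_one]
  exact W.charMat_simple hs one_pos one_pos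

theorem isKthEigenvalue_charMat_one [Nonempty S] : IsKthEigenvalue (W.charMat 1 1) 0 1 := by
  rw [charMat_one]
  exact isKthEigenvalue_zero_of_stochastic W.P_nonneg W.P_sum

/-- Move along `β = α = t`. At `t = 1` the slope of `det (I - A(t,t))` is a positive multiple of the
drift with `μ₁`, negative by stability. For `ρ₂` the curve is `α = 1` and the drift is the one with
`μ₂`. -/
theorem exists_isRho1 [Nonempty S] (hs : W.SimpleEigenvalues) (hst : W.Stable) :
    ∃ r, W.IsRho1 r := by
  obtain ⟨π, -, hπ, hπP, hd, -⟩ := hst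
  obtain ⟨c, hc, hadj⟩ := exists_adjugate_eq hs hπ hπP
  have hder := W.hasDerivAt_det_charMat (f := fun t => t) (g := fun t => t) (t := 1)
    (D := fun m => W.mu1 m - W.lam m) fun m => by
      have h1 := ((hasDerivAt_inv (one_ne_zero (α := ℝ))).const_mul (W.lam m)).add
        ((hasDerivAt_id (1 : ℝ)).const_mul (W.mu1 m))
      have h2 := h1.add (((hasDerivAt_id (1 : ℝ)).div (hasDerivAt_id (1 : ℝ))
        one_ne_zero).const_mul (W.mu2 m))
      convert! h2 using 1
      · ext t
        simp
      · simp
        ring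
  obtain ⟨t, ht, hk⟩ := exists_isKthEigenvalue_zero (A := fun t => W.charMat t t)
    (fun t ht => W.continuousAt_charMat continuousAt_id continuousAt_id ht.ne' ht.ne')
    (fun t ht => W.charMat_simple hs ht ht) isKthEigenvalue_charMat_one hder
    (by
      have : ∑ m, -(W.P m m * (W.mu1 m - W.lam m)) * (1 - W.charMat 1 1).adjugate m m =
          c * ∑ m, (W.lam m - W.mu1 m) * π m * W.P m m := by
        rw [Finset.mul_sum]
        refine Finset.sum_congr rfl fun m _ => ?_
        rw [hadj]
        ring
      rw [this]
      exact mul_neg_of_pos_of_neg hc hd)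
    (W.eventually_one_lt_of_lam fun t ht => ht)
  exact ⟨t, ht.1, ht.2, ⟨ht.1, ht.1, hk⟩, ht.1, ht.1, by rwa [W.charMat_self t ht.1.ne']⟩

theorem exists_isRho2 [Nonempty S] (hs : W.SimpleEigenvalues) (hst : W.Stable) :
    ∃ r, W.IsRho2 r := by
  obtain ⟨π, -, hπ, hπP, -, hd⟩ := hst
  obtain ⟨c, hc, hadj⟩ := exists_adjugate_eq hs hπ hπP
  have hder := W.hasDerivAt_det_charMat (f := fun t => t) (g := fun _ => 1) (t := 1)
    (D := fun m => W.mu2 m - W.lam m) fun m => by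
      have h1 := ((hasDerivAt_inv (one_ne_zero (α := ℝ))).const_mul (W.lam m)).add_const
        (W.mu1 m)
      have h2 := h1.add ((hasDerivAt_id (1 : ℝ)).const_mul (W.mu2 m))
      convert! h2 using 1
      · ext t
        simp
      · simp
        ring
  obtain ⟨t, ht, hk⟩ := exists_isKthEigenvalue_zero (A := fun t => W.charMat t 1)
    (fun t ht => W.continuousAt_charMat continuousAt_id continuousAt_const ht.ne' one_ne_zero)
    (fun t ht => W.charMat_simple hs ht one_pos) isKthEigenvalue_charMat_one hder
    (by
      have : ∑ m, -(W.P m m * (W.mu2 m - W.lam m)) * (1 - W.charMat 1 1).adjugate m m =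
          c * ∑ m, (W.lam m - W.mu2 m) * π m * W.P m m := by
        rw [Finset.mul_sum]
        refine Finset.sum_congr rfl fun m _ => ?_
        rw [hadj]
        ring
      rw [this]
      exact mul_neg_of_pos_of_neg hc hd)
    (W.eventually_one_lt_of_lam fun _ _ => one_pos)
  exact ⟨t, ht.1, ht.2, ht.1, one_pos, hk⟩

/-- The conjugate point of `(ρ₂, 1)` on the level curve of the largest eigenvalue. -/
theorem exists_conjugate_zero [Nonempty S] (hs : W.SimpleEigenvalues) (hc : W.ConjCondition)
    (hρ : W.IsRho2 W.rho2) : ∃ α ∈ Set.Ioo (0 : ℝ) 1, IsKthEigenvalue (W.charMat W.rho2 α) 0 1 := by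
  have hder := W.hasDerivAt_det_charMat (f := fun _ => W.rho2) (g := fun t => t) (t := 1)
    (D := fun m => W.mu1 m - W.rho2 * W.mu2 m) fun m => by
      have h1 := ((hasDerivAt_id (1 : ℝ)).const_mul (W.mu1 m)).const_add
        (W.lam m * (1 / W.rho2))
      have h2 := h1.add
        (((hasDerivAt_inv (one_ne_zero (α := ℝ))).const_mul W.rho2).const_mul (W.mu2 m))
      convert! h2 using 1
      simp
      ring
  refine exists_isKthEigenvalue_zero (A := fun t => W.charMat W.rho2 t)
    (fun t ht => W.continuousAt_charMat continuousAt_const continuousAt_id hρ.1.ne' ht.ne')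
    (fun t ht => W.charMat_simple hs hρ.1 ht) hρ.2.2.2.2 hder ?_
    (W.eventually_one_lt_of_mu2 hρ.1)
  -- The slope in `α` at `(ρ₂, 1)` is precisely the sum in `ConjCondition`.
  refine lt_of_eq_of_lt (Finset.sum_congr rfl fun m _ => ?_) hc
  rw [adjugate_apply_self]
  ring

theorem exists_conjugate_ne_zero (hs : W.SimpleEigenvalues) (hρ : W.IsRho2 W.rho2)
    {α : ℝ} (hα : 0 < α) (h : IsKthEigenvalue (W.charMat W.rho2 α) 0 1) {k : ℕ} (hk0 : k ≠ 0)
    (hk : k < Fintype.card S) :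
    ∃ t ∈ Set.Ioo 0 α, IsKthEigenvalue (W.charMat W.rho2 t) k 1 :=
  exists_isKthEigenvalue_lt (A := fun t => W.charMat W.rho2 t)
    (fun _ ht => W.continuousAt_charMat continuousAt_const continuousAt_id hρ.1.ne' ht.ne')
    (fun _ ht => W.charMat_simple hs hρ.1 ht) hα h (W.eventually_one_lt_of_mu2 hρ.1) hk0 hk

end ModulatedTandem

/-! ### Perron–Frobenius by the Collatz–Wielandt maximum. -/

section Perron

variable {S : Type*} [Fintype S]

theorem Matrix.mulVec_pos_of_pos {B : Matrix S S ℝ} (hB : ∀ i j, 0 < B i j) {y : S → ℝ}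
    (hy : ∀ i, 0 ≤ y i) (hy0 : y ≠ 0) (i : S) : 0 < B.mulVec y i := by
  obtain ⟨j, hj⟩ := Function.ne_iff.1 hy0
  exact Finset.sum_pos' (fun k _ => mul_nonneg (hB i k).le (hy k))
    ⟨j, Finset.mem_univ j, mul_pos (hB i j) (lt_of_le_of_ne (hy j) (Ne.symm hj))⟩

variable [DecidableEq S]

/-- Every entry is positive in some power, and the sum of the chosen exponents bounds each of them.
The result is a positive matrix commuting with `M`, available without aperiodicity. -/
theorem Matrix.IsIrreducible.exists_sum_pow_pos {M : Matrix S S ℝ} (h : M.IsIrreducible) :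
    ∃ N : ℕ, ∀ i j, 0 < (∑ k ∈ Finset.range N, M ^ k) i j := by
  have h1 := (Matrix.isIrreducible_iff_exists_pow_pos h.nonneg).1 h
  choose f hf0 hf using h1
  refine ⟨(∑ i, ∑ j, f i j) + 1, fun i j => ?_⟩
  rw [Matrix.sum_apply]
  refine Finset.sum_pos' (fun k _ => Matrix.pow_apply_nonneg h.nonneg k i j)
    ⟨f i j, Finset.mem_range.2 (Nat.lt_succ_of_le ?_), hf i j⟩
  exact (Finset.single_le_sum (f := fun j => f i j) (fun _ _ => Nat.zero_le _)
    (Finset.mem_univ j)).trans (Finset.single_le_sum (f := fun i => ∑ j, f i j)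
      (fun _ _ => Nat.zero_le _) (Finset.mem_univ i))

/-- Vectors `x ≥ 0`, `x ≠ 0` with `r x ≤ M x` for the largest possible `r`. -/
theorem exists_max_collatzWielandt [Nonempty S] {M : Matrix S S ℝ} (h0 : ∀ i j, 0 ≤ M i j) :
    ∃ (r : ℝ) (x : S → ℝ), 0 ≤ r ∧ (∀ i, 0 ≤ x i) ∧ x ≠ 0 ∧ (∀ i, r * x i ≤ M.mulVec x i) ∧
      ∀ (s : ℝ) (y : S → ℝ), 0 ≤ s → (∀ i, 0 ≤ y i) → y ≠ 0 → (∀ i, s * y i ≤ M.mulVec y i) →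
        s ≤ r := by
  set C := ∑ i, ∑ j, M i j
  have hC : 0 ≤ C := Finset.sum_nonneg fun i _ => Finset.sum_nonneg fun j _ => h0 i j
  -- Normalising to the simplex gives compactness; summing `s * y i ≤ (M y) i` over `i` shows that
  -- `C` bounds every admissible `s`.
  set K : Set (ℝ × (S → ℝ)) :=
    (Set.Icc 0 C ×ˢ stdSimplex ℝ S) ∩ {p | ∀ i, p.1 * p.2 i ≤ M.mulVec p.2 i}
  have hK : IsCompact K := by
    refine (isCompact_Icc.prod (isCompact_stdSimplex ℝ S)).inter_right ?_
    simp only [Set.ofPred_forall]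
    refine isClosed_iInter fun i => isClosed_le (by fun_prop) ?_
    exact (continuous_apply i).comp (continuous_const.matrix_mulVec continuous_snd)
  have hKne : K.Nonempty := by
    obtain ⟨i⟩ := ‹Nonempty S›
    refine ⟨(0, Pi.single i 1), ⟨⟨le_rfl, hC⟩, single_mem_stdSimplex ℝ i⟩, fun j => ?_⟩
    simp [h0]
  obtain ⟨⟨r, x⟩, ⟨⟨hr, hx⟩, hrx⟩, hmax⟩ := hK.exists_isMaxOn hKne continuous_fst.continuousOn
  refine ⟨r, x, hr.1, hx.1, ?_, hrx, fun s y hs hy hy0 hsy => ?_⟩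
  · rintro rfl
    simpa using hx.2
  have hsum : 0 < ∑ i, y i := by
    obtain ⟨j, hj⟩ := Function.ne_iff.1 hy0
    exact Finset.sum_pos' (fun k _ => hy k) ⟨j, Finset.mem_univ j, lt_of_le_of_ne (hy j) (Ne.symm hj)⟩
  set c := (∑ i, y i)⁻¹
  have hc : 0 < c := inv_pos.2 hsum
  have hcy : c • y ∈ stdSimplex ℝ S := by
    refine ⟨fun i => mul_nonneg hc.le (hy i), ?_⟩
    simp only [Pi.smul_apply, smul_eq_mul, ← Finset.mul_sum]
    exact inv_mul_cancel₀ hsum.ne'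
  have hscy : ∀ i, s * (c • y) i ≤ M.mulVec (c • y) i := fun i => by
    rw [Matrix.mulVec_smul, Pi.smul_apply, Pi.smul_apply, smul_eq_mul, smul_eq_mul]
    nlinarith [mul_le_mul_of_nonneg_left (hsy i) hc.le]
  have hle1 : ∀ j, (c • y) j ≤ 1 := fun j => by
    rw [← hcy.2]
    exact Finset.single_le_sum (fun i _ => hcy.1 i) (Finset.mem_univ j)
  have hsC : s ≤ C := by
    calc s = ∑ i, s * (c • y) i := by rw [← Finset.mul_sum, hcy.2, mul_one]
      _ ≤ ∑ i, M.mulVec (c • y) i := Finset.sum_le_sum fun i _ => hscy i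
      _ ≤ C := Finset.sum_le_sum fun i _ => Finset.sum_le_sum fun j _ =>
          mul_le_of_le_one_right (h0 i j) (hle1 j)
  exact hmax (show (s, c • y) ∈ K from ⟨⟨⟨hs, hsC⟩, hcy⟩, hscy⟩)

/-- Perron–Frobenius: a nonnegative irreducible matrix whose largest real eigenvalue is `1` has a
positive eigenvector for it. -/
theorem Matrix.IsIrreducible.exists_pos_mulVec_eq [Nonempty S] {M : Matrix S S ℝ}
    (h : M.IsIrreducible) (htop : IsKthEigenvalue M 0 1) :
    ∃ v : S → ℝ, (∀ m, 0 < v m) ∧ M.mulVec v = v := by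
  obtain ⟨r, x, hr, hx, hx0, hrx, hmax⟩ := exists_max_collatzWielandt h.nonneg
  obtain ⟨N, hB⟩ := h.exists_sum_pow_pos
  set B := ∑ k ∈ Finset.range N, M ^ k
  have hcomm : M * B = B * M := by
    rw [Finset.mul_sum, Finset.sum_mul]
    exact Finset.sum_congr rfl fun k _ => (pow_succ' M k).symm.trans (pow_succ M k)
  have hBx := Matrix.mulVec_pos_of_pos hB hx hx0
  have heig : M.mulVec x = r • x := by
    by_contra hne
    have hy := Matrix.mulVec_pos_of_pos hB (y := M.mulVec x - r • x)
      (fun i => by simpa using hrx i) (sub_ne_zero.2 hne)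
    have hlt : ∀ i, r * B.mulVec x i < M.mulVec (B.mulVec x) i := fun i => by
      have := hy i
      rw [Matrix.mulVec_sub, Matrix.mulVec_smul, Matrix.mulVec_mulVec, ← hcomm,
        ← Matrix.mulVec_mulVec] at this
      simpa using this
    obtain ⟨i, -, hi⟩ := Finset.exists_min_image Finset.univ
      (fun i => M.mulVec (B.mulVec x) i / B.mulVec x i) Finset.univ_nonempty
    have h1 : r < M.mulVec (B.mulVec x) i / B.mulVec x i := (lt_div_iff₀ (hBx i)).2 (hlt i)
    refine absurd (hmax _ (B.mulVec x) (hr.trans h1.le) (fun j => (hBx j).le) (fun h => ?_)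
      fun j => (le_div_iff₀ (hBx j)).1 (hi j (Finset.mem_univ j))) (not_le.2 h1)
    exact (hBx i).ne' (congrFun h i)
  have hBr : B.mulVec x = (∑ k ∈ Finset.range N, r ^ k) • x := by
    have : ∀ k, (M ^ k).mulVec x = r ^ k • x := fun k => by
      induction k with
      | zero => simp
      | succ k ih => rw [pow_succ, ← Matrix.mulVec_mulVec, heig, Matrix.mulVec_smul, ih,
          smul_smul, pow_succ']
    rw [Matrix.sum_mulVec, Finset.sum_smul]
    exact Finset.sum_congr rfl fun k _ => this k
  have hxpos : ∀ i, 0 < x i := fun i => by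
    refine lt_of_le_of_ne (hx i) fun h => ?_
    have := hBx i
    rw [hBr, Pi.smul_apply, ← h, smul_zero] at this
    exact lt_irrefl _ this
  rw [isKthEigenvalue_iff, Finset.card_eq_zero, Finset.filter_eq_empty_iff] at htop
  have hr1 : r ≤ 1 := by
    refine not_lt.1 (htop.2 (mem_realEigs_iff_hasEigenvalue.2 ?_))
    refine Module.End.hasEigenvalue_of_hasEigenvector (x := x) ⟨?_, hx0⟩
    rw [Module.End.mem_eigenspace_iff]
    simpa using heig
  -- The absolute values of an eigenvector for `1` are admissible with ratio `1`.
  have h1r : 1 ≤ r := by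
    obtain ⟨u, hu, hu0⟩ := (mem_realEigs_iff_hasEigenvalue.1 htop.1).exists_hasEigenvector
    rw [Module.End.mem_eigenspace_iff, Matrix.toLin'_apply, one_smul] at hu
    refine hmax 1 (fun i => |u i|) zero_le_one (fun i => abs_nonneg _) (fun h => hu0 ?_) fun i => ?_
    · ext i
      exact abs_eq_zero.1 (congrFun h i)
    · rw [one_mul]
      conv_lhs => rw [← hu]
      refine (Finset.abs_sum_le_sum_abs _ _).trans_eq (Finset.sum_congr rfl fun j _ => ?_)
      rw [abs_mul, abs_of_nonneg (h.nonneg i j)]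
  refine ⟨x, hxpos, ?_⟩
  rw [heig, le_antisymm hr1 h1r, one_smul]

end Perron

/-! ### Positive eigenvectors and the full set of conjugate points. -/

namespace ModulatedTandem

variable {S : Type*} [Fintype S] [DecidableEq S] {W : ModulatedTandem S}

theorem charMat_diag_pos {β α : ℝ} (hβ : 0 < β) (hα : 0 < α) (m : S) :
    0 < W.charMat β α m m := by
  rw [charMat_diag]
  have h1 := W.P_diag_pos m
  have h2 := W.mu1_nonneg m
  have h3 := W.mu2_pos m
  have h4 := W.lam_pos m
  positivity

/-- Irreducibility depends only on which entries are positive, and these are the same as for `P`,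
both diagonals being positive. -/
theorem charMat_isIrreducible (h : W.P.IsIrreducible) {β α : ℝ} (hβ : 0 < β) (hα : 0 < α) :
    (W.charMat β α).IsIrreducible := by
  have hq : (W.charMat β α).toQuiver = W.P.toQuiver := by
    unfold Matrix.toQuiver
    congr 1
    ext m n
    rcases eq_or_ne m n with rfl | hmn
    · simp [charMat_diag_pos hβ hα, W.P_diag_pos]
    · rw [W.charMat_off _ _ hmn]
  refine ⟨fun m n => ?_, hq ▸ h.connected⟩
  rcases eq_or_ne m n with rfl | hmn
  · exact (charMat_diag_pos hβ hα m).le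
  · rw [W.charMat_off _ _ hmn]
    exact W.P_nonneg m n

theorem nonempty_conjugatePoints [Nonempty S] (hirr : W.P.IsIrreducible)
    (hs : W.SimpleEigenvalues) (hc : W.ConjCondition) (hρ1 : W.IsRho1 W.rho1)
    (hρ2 : W.IsRho2 W.rho2) : Nonempty W.ConjugatePoints := by
  obtain ⟨d1, hd1, hd1'⟩ := (charMat_isIrreducible hirr hρ1.1 hρ1.1).exists_pos_mulVec_eq
    hρ1.2.2.1.2.2
  obtain ⟨d2, hd2, hd2'⟩ := (charMat_isIrreducible hirr hρ2.1 one_pos).exists_pos_mulVec_eq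
    hρ2.2.2.2.2
  obtain ⟨α₀, hα₀, hα₀'⟩ := exists_conjugate_zero hs hc hρ2
  -- All indices refer to the same `α₀`, which is recorded so that the separate choices remain
  -- comparable.
  have hα : ∀ j : Fin (Fintype.card S), ∃ t, 0 < t ∧ IsKthEigenvalue (W.charMat W.rho2 t) j 1 ∧
      ((j : ℕ) = 0 → t = α₀) ∧ ((j : ℕ) ≠ 0 → t < α₀) := fun j => by
    by_cases hj : (j : ℕ) = 0
    · exact ⟨α₀, hα₀.1, hj ▸ hα₀', fun _ => rfl, fun h => absurd hj h⟩
    · obtain ⟨t, ht, htk⟩ := exists_conjugate_ne_zero hs hρ2 hα₀.1 hα₀' hj j.2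
      exact ⟨t, ht.1, htk, fun h => absurd h hj, fun _ => ht.2⟩
  choose α hpos hlev hzero hne using hα
  have he : ∀ j, ∃ e : S → ℝ, e ≠ 0 ∧ (W.charMat W.rho2 (α j)).mulVec e = e := fun j => by
    obtain ⟨u, hu, hu0⟩ := (hlev j).1.exists_hasEigenvector
    rw [Module.End.mem_eigenspace_iff, Matrix.toLin'_apply, one_smul] at hu
    exact ⟨u, hu0, hu⟩
  choose e he0 he' using he
  exact ⟨⟨d1, hd1, hd1', d2, hd2, hd2', α, fun j => ⟨hρ2.1, hpos j, hlev j⟩,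
    fun j hj => hzero j hj ▸ hα₀.2, fun i j hi hj => hzero i hi ▸ hne j hj, e, he0, he'⟩⟩

end ModulatedTandem

/-! ### Effect of the jumps on the level `y1 - y2`. -/

namespace TandemState

variable {S : Type*}

instance : MeasurableSingletonClass (TandemState S) := ⟨fun _ => trivial⟩

instance : DiscreteMeasurableSpace (TandemState S) := ⟨fun _ => trivial⟩

theorem jump_left (s : TandemState S) : s.jump (-1, 0) = ⟨s.y1 - 1, s.y2, s.mode⟩ := by
  simp [jump, sub_eq_add_neg]

theorem jump_up (s : TandemState S) : s.jump (1, 1) = ⟨s.y1 + 1, s.y2 + 1, s.mode⟩ := by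
  have : (0 : ℤ) ≤ (s.y2 : ℤ) + 1 := by positivity
  simp [jump, this]

theorem jump_down (s : TandemState S) (h : s.y2 ≠ 0) :
    s.jump (0, -1) = ⟨s.y1, s.y2 - 1, s.mode⟩ := by
  have : (0 : ℤ) ≤ (s.y2 : ℤ) + -1 := by omega
  simp [jump, this]
  omega

theorem jump_down_zero (s : TandemState S) (h : s.y2 = 0) : s.jump (0, -1) = s := by
  simp [jump, h]

/-- The distance `y1 - y2` from the exit boundary. -/
def level (s : TandemState S) : ℤ := s.y1 - s.y2

theorem mem_regionB_iff {s : TandemState S} : s ∈ regionB S ↔ 0 ≤ s.level := by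
  simp [regionB, level]

theorem mem_boundaryB_iff {s : TandemState S} : s ∈ boundaryB S ↔ s.level = 0 := by
  simp [boundaryB, level, sub_eq_zero]

theorem level_jump_left (s : TandemState S) : (s.jump (-1, 0)).level = s.level - 1 := by
  rw [jump_left]
  simp only [level]
  ring

theorem level_jump_up (s : TandemState S) : (s.jump (1, 1)).level = s.level := by
  rw [jump_up]
  simp [level]

theorem level_le_level_jump_down (s : TandemState S) : s.level ≤ (s.jump (0, -1)).level := by
  by_cases h : s.y2 = 0
  · rw [jump_down_zero s h]
  · rw [jump_down s h]
    simp only [level]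
    omega

end TandemState

/-! ### One-step expectations and the Markov property. -/

namespace ModulatedTandem

open TandemState

variable {S : Type*} [Fintype S] [DecidableEq S] (W : ModulatedTandem S)

theorem integrable_stepKernel (h : TandemState S → ℝ) (s : TandemState S) :
    Integrable h (W.stepKernel s) := by
  have hd : ∀ z, Integrable h (Measure.dirac z) := fun z => integrable_dirac (by simp)
  change Integrable h (W.stepLaw s)
  refine integrable_finsetSum_measure.2 fun n _ => ?_
  refine Integrable.smul_measure ?_ ENNReal.ofReal_ne_top
  split_ifs
  · exact (((hd _).smul_measure ENNReal.ofReal_ne_top).add_measure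
      ((hd _).smul_measure ENNReal.ofReal_ne_top)).add_measure
      ((hd _).smul_measure ENNReal.ofReal_ne_top)
  · exact hd _

/-- The one-step expectation. -/
theorem integral_stepKernel (h : TandemState S → ℝ) (s : TandemState S) :
    ∫ z, h z ∂(W.stepKernel s) = ∑ n, W.P s.mode n *
      (if n = s.mode then W.lam s.mode * h (s.jump (-1, 0)) + W.mu1 s.mode * h (s.jump (1, 1)) +
        W.mu2 s.mode * h (s.jump (0, -1)) else h ⟨s.y1, s.y2, n⟩) := by
  have hd : ∀ z, Integrable h (Measure.dirac z) := fun z => integrable_dirac (by simp)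
  have hd' : ∀ (c : ℝ) z, Integrable h (ENNReal.ofReal c • Measure.dirac z) := fun c z =>
    (hd z).smul_measure ENNReal.ofReal_ne_top
  change ∫ z, h z ∂(W.stepLaw s) = _
  rw [stepLaw, integral_finsetSum_measure]
  · refine Finset.sum_congr rfl fun n _ => ?_
    rw [integral_smul_measure, ENNReal.toReal_ofReal (W.P_nonneg _ _), smul_eq_mul]
    congr 1
    split_ifs
    · rw [integral_add_measure ((hd' _ _).add_measure (hd' _ _)) (hd' _ _),
        integral_add_measure (hd' _ _) (hd' _ _)]
      simp [integral_smul_measure, ENNReal.toReal_ofReal, (W.lam_pos _).le, W.mu1_nonneg,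
        (W.mu2_pos _).le]
    · simp
  · intro n _
    refine Integrable.smul_measure ?_ ENNReal.ofReal_ne_top
    split_ifs
    · exact ((hd' _ _).add_measure (hd' _ _)).add_measure (hd' _ _)
    · exact hd _

theorem stepKernel_real (s : TandemState S) (A : Set (TandemState S)) :
    (W.stepKernel s).real A = ∫ z, A.indicator 1 z ∂(W.stepKernel s) :=
  (integral_indicator_one (MeasurableSet.of_discrete)).symm

theorem le_stepKernel_real {s : TandemState S} {A : Set (TandemState S)}
    (h : s.jump (-1, 0) ∈ A) :
    W.P s.mode s.mode * W.lam s.mode ≤ (W.stepKernel s).real A := by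
  have h0 : ∀ z, 0 ≤ A.indicator (1 : TandemState S → ℝ) z := fun z =>
    Set.indicator_nonneg (fun _ _ => zero_le_one) z
  rw [stepKernel_real, integral_stepKernel]
  have h1 := W.lam_pos s.mode
  have h2 := W.mu1_nonneg s.mode
  have h3 := W.mu2_pos s.mode
  refine le_trans ?_ (Finset.single_le_sum (fun n _ => mul_nonneg (W.P_nonneg _ _) ?_)
    (Finset.mem_univ s.mode))
  · rw [if_pos rfl, Set.indicator_of_mem h, Pi.one_apply, mul_one]
    refine mul_le_mul_of_nonneg_left ?_ (W.P_nonneg _ _)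
    have := mul_nonneg h2 (h0 (s.jump (1, 1)))
    have := mul_nonneg h3.le (h0 (s.jump (0, -1)))
    linarith
  · split_ifs
    · have := mul_nonneg h2 (h0 (s.jump (1, 1)))
      have := mul_nonneg h3.le (h0 (s.jump (0, -1)))
      have := mul_nonneg h1.le (h0 (s.jump (-1, 0)))
      linarith
    · exact h0 _

/-- One-step expectations from a state with positive level depend on the values in `B` only. -/
theorem integral_stepKernel_congr {s : TandemState S} (hs : 0 < s.level)
    {g h : TandemState S → ℝ} (hgh : ∀ z ∈ regionB S, g z = h z) :
    ∫ z, g z ∂(W.stepKernel s) = ∫ z, h z ∂(W.stepKernel s) := by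
  rw [integral_stepKernel, integral_stepKernel]
  refine Finset.sum_congr rfl fun n _ => ?_
  congr 1
  rw [hgh _ (mem_regionB_iff.2 (by rw [level_jump_left]; omega)),
    hgh _ (mem_regionB_iff.2 (by rw [level_jump_up]; omega)),
    hgh _ (mem_regionB_iff.2 (hs.le.trans (level_le_level_jump_down s))),
    hgh ⟨s.y1, s.y2, n⟩ (mem_regionB_iff.2 hs.le)]

theorem stepKernel_real_compl_regionB {s : TandemState S} (hs : 0 < s.level) :
    (W.stepKernel s).real (regionB S)ᶜ = 0 := by
  rw [stepKernel_real, W.integral_stepKernel_congr hs (h := 0), Pi.zero_def, integral_zero]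
  intro z hz
  simp [hz]

instance (s : TandemState S) : IsProbabilityMeasure (W.pathLaw s) := by
  unfold pathLaw
  infer_instance

omit [Fintype S] [DecidableEq S] in
theorem measurableSet_piLE {k n : ℕ} (h : k ≤ n) (A : Set (TandemState S)) :
    MeasurableSet[Filtration.piLE (X := fun _ : ℕ => TandemState S) n] {ω | ω k ∈ A} := by
  refine ⟨{x | x ⟨k, Set.mem_Iic.2 h⟩ ∈ A}, ?_, rfl⟩
  exact measurable_pi_apply _ (MeasurableSet.of_discrete (s := A))

/-- The Markov property at time `n`. -/
theorem setIntegral_pathLaw_succ (s : TandemState S) {n : ℕ} {F : Set (ℕ → TandemState S)}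
    (hF : MeasurableSet[Filtration.piLE (X := fun _ : ℕ => TandemState S) n] F)
    {g : TandemState S → ℝ} {C : ℝ} (hg : ∀ z, |g z| ≤ C) :
    ∫ ω in F, g (ω (n + 1)) ∂(W.pathLaw s) =
      ∫ ω in F, (∫ z, g z ∂(W.stepKernel (ω n))) ∂(W.pathLaw s) := by
  rw [Filtration.piLE_eq_comap_frestrictLe] at hF
  obtain ⟨E, hE, rfl⟩ := hF
  set κ := fun n : ℕ => W.stepKernel.comap
      (fun x : (i : Finset.Iic n) → TandemState S => x ⟨n, Finset.mem_Iic.2 le_rfl⟩)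
      (measurable_pi_apply _)
  have hgm : Measurable g := measurable_from_top
  have hE' : MeasurableSet (Preorder.frestrictLe (π := fun _ : ℕ => TandemState S) n ⁻¹' E) :=
    Preorder.measurable_frestrictLe n hE
  -- The joint law of the history up to `n` and the next state is the law of the history composed
  -- with one step of the kernel; integrating out the last coordinate is the Markov property.
  have hmap := Kernel.partialTraj_compProd_eq_map_traj (X := fun _ : ℕ => TandemState S) (κ := κ) (Nat.zero_le n)
    (x₀ := fun _ => s)
  have hmap' := Kernel.traj_map_frestrictLe_apply (X := fun _ : ℕ => TandemState S) (κ := κ) 0 n (fun _ => s)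
  have hf : Measurable fun p : ((i : Finset.Iic n) → TandemState S) × TandemState S =>
      E.indicator (fun _ => (1 : ℝ)) p.1 * g p.2 :=
    ((measurable_const.indicator hE).comp measurable_fst).mul (hgm.comp measurable_snd)
  have hK : Measurable fun z : TandemState S => ∫ w, g w ∂(W.stepKernel z) := measurable_from_top
  rw [← integral_indicator hE', ← integral_indicator hE']
  calc _ = ∫ ω, E.indicator (fun _ => (1 : ℝ)) (Preorder.frestrictLe n ω) * g (ω (n + 1))
        ∂(W.pathLaw s) := by
        refine integral_congr_ae (Eventually.of_forall fun ω => ?_)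
        by_cases hω : Preorder.frestrictLe n ω ∈ E
        · rw [Set.indicator_of_mem (show ω ∈ Preorder.frestrictLe n ⁻¹' E from hω)]
          simp [hω]
        · rw [Set.indicator_of_notMem (show ω ∉ Preorder.frestrictLe n ⁻¹' E from hω)]
          simp [hω]
    _ = ∫ p, E.indicator (fun _ => (1 : ℝ)) p.1 * g p.2
        ∂((Kernel.traj (X := fun _ : ℕ => TandemState S) κ 0 (fun _ => s)).map
          (fun x => (Preorder.frestrictLe n x, x (n + 1)))) := by
        rw [integral_map (by fun_prop) hf.aestronglyMeasurable]
        rfl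
    _ = ∫ x, ∫ z, E.indicator (fun _ => (1 : ℝ)) x * g z ∂(κ n x)
        ∂(Kernel.partialTraj (X := fun _ : ℕ => TandemState S) κ 0 n (fun _ => s)) := by
        rw [← hmap, Measure.integral_compProd]
        refine Integrable.of_bound hf.aestronglyMeasurable C (Eventually.of_forall fun p => ?_)
        rw [norm_mul]
        have h1 : ‖E.indicator (fun _ => (1 : ℝ)) p.1‖ ≤ 1 := by
          by_cases hp : p.1 ∈ E <;> simp [hp]
        calc _ ≤ 1 * ‖g p.2‖ := by gcongr
          _ ≤ C := by rw [one_mul]; exact hg _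
    _ = ∫ x, E.indicator (fun _ => (1 : ℝ)) x *
          ∫ z, g z ∂(W.stepKernel (x ⟨n, Finset.mem_Iic.2 le_rfl⟩))
        ∂(Kernel.partialTraj (X := fun _ : ℕ => TandemState S) κ 0 n (fun _ => s)) := by
        refine integral_congr_ae (Eventually.of_forall fun x => ?_)
        exact integral_const_mul _ _
    _ = _ := by
        rw [← hmap', integral_map (by fun_prop)]
        · refine integral_congr_ae (Eventually.of_forall fun ω => ?_)
          by_cases hω : Preorder.frestrictLe n ω ∈ E
          · rw [Set.indicator_of_mem (show ω ∈ Preorder.frestrictLe n ⁻¹' E from hω)]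
            simp [hω]
          · rw [Set.indicator_of_notMem (show ω ∉ Preorder.frestrictLe n ⁻¹' E from hω)]
            simp [hω]
        · exact ((measurable_const.indicator hE).mul
            (hK.comp (measurable_pi_apply _))).aestronglyMeasurable

theorem measureReal_pathLaw_succ (s : TandemState S) {n : ℕ} {F : Set (ℕ → TandemState S)}
    (hF : MeasurableSet[Filtration.piLE (X := fun _ : ℕ => TandemState S) n] F)
    (A : Set (TandemState S)) :
    (W.pathLaw s).real (F ∩ {ω | ω (n + 1) ∈ A}) =
      ∫ ω in F, (W.stepKernel (ω n)).real A ∂(W.pathLaw s) := by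
  have h := W.setIntegral_pathLaw_succ s hF (g := A.indicator 1) (C := 1) fun z => by
    by_cases hz : z ∈ A <;> simp [hz]
  simp only [stepKernel_real]
  rw [← h]
  have hA : MeasurableSet {ω : ℕ → TandemState S | ω (n + 1) ∈ A} :=
    measurable_pi_apply _ (MeasurableSet.of_discrete (s := A))
  have h1 : (fun ω : ℕ → TandemState S => A.indicator (1 : TandemState S → ℝ) (ω (n + 1))) =
      {ω | ω (n + 1) ∈ A}.indicator 1 := by
    ext ω
    by_cases hω : ω (n + 1) ∈ A
    · rw [Set.indicator_of_mem hω, Set.indicator_of_mem (show ω ∈ {ω | ω (n + 1) ∈ A} from hω)]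
      rfl
    · rw [Set.indicator_of_notMem hω,
        Set.indicator_of_notMem (show ω ∉ {ω | ω (n + 1) ∈ A} from hω)]
  rw [h1, integral_indicator_one hA, measureReal_restrict_apply hA, Set.inter_comm]

theorem mul_le_measureReal_pathLaw_succ (s : TandemState S) {n : ℕ}
    {F : Set (ℕ → TandemState S)}
    (hF : MeasurableSet[Filtration.piLE (X := fun _ : ℕ => TandemState S) n] F)
    {A : Set (TandemState S)} {δ : ℝ} (hδ : ∀ ω ∈ F, δ ≤ (W.stepKernel (ω n)).real A) :
    δ * (W.pathLaw s).real F ≤ (W.pathLaw s).real (F ∩ {ω | ω (n + 1) ∈ A}) := by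
  have hF' : MeasurableSet F := Filtration.piLE.le n _ hF
  have hK : Measurable fun z : TandemState S => (W.stepKernel z).real A := measurable_from_top
  rw [W.measureReal_pathLaw_succ s hF]
  have h1 : ∫ ω in F, δ ∂(W.pathLaw s) ≤ ∫ ω in F, (W.stepKernel (ω n)).real A ∂(W.pathLaw s) := by
    refine setIntegral_mono_on (integrable_const _) ?_ hF' hδ
    refine Integrable.of_bound (hK.comp (measurable_pi_apply n)).aestronglyMeasurable 1
      (Eventually.of_forall fun ω => ?_)
    rw [Real.norm_of_nonneg measureReal_nonneg]
    exact measureReal_le_one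
  simpa [mul_comm] using h1

theorem pathLaw_ae_zero (s : TandemState S) : ∀ᵐ ω ∂(W.pathLaw s), ω 0 = s := by
  set κ := fun n : ℕ => W.stepKernel.comap
      (fun x : (i : Finset.Iic n) → TandemState S => x ⟨n, Finset.mem_Iic.2 le_rfl⟩)
      (measurable_pi_apply _)
  have hmap := Kernel.traj_map_frestrictLe_apply (X := fun _ : ℕ => TandemState S) (κ := κ) 0 0 (fun _ => s)
  rw [Kernel.partialTraj_self, Kernel.id_apply] at hmap
  have h1 : ∀ᵐ x ∂((Kernel.traj (X := fun _ : ℕ => TandemState S) κ 0 (fun _ => s)).map (Preorder.frestrictLe 0)),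
      x ⟨0, Finset.mem_Iic.2 le_rfl⟩ = s := by
    rw [hmap, ae_dirac_iff]
    have hm : Measurable fun x : Finset.Iic 0 → TandemState S => x ⟨0, Finset.mem_Iic.2 le_rfl⟩ :=
      measurable_pi_apply _
    exact hm (MeasurableSet.of_discrete (s := ({s} : Set (TandemState S))))
  exact ae_of_ae_map (by fun_prop) h1

/-- A step lowers the level by at most one, so almost no path jumps across `∂B`. -/
theorem pathLaw_ae_succ (s : TandemState S) :
    ∀ᵐ ω ∂(W.pathLaw s), ∀ n, 0 < (ω n).level → ω (n + 1) ∈ regionB S := by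
  refine ae_all_iff.2 fun n => ?_
  have h1 := W.measureReal_pathLaw_succ s (measurableSet_piLE (le_refl n) {z | 0 < z.level})
    (regionB S)ᶜ
  have h2 : ∫ ω in {ω | ω n ∈ {z : TandemState S | 0 < z.level}},
      (W.stepKernel (ω n)).real (regionB S)ᶜ ∂(W.pathLaw s) = 0 := by
    refine setIntegral_eq_zero_of_forall_eq_zero fun ω hω => ?_
    exact W.stepKernel_real_compl_regionB hω
  rw [h2, measureReal_eq_zero_iff] at h1
  refine (measure_eq_zero_iff_ae_notMem.1 h1).mono fun ω hω hl => ?_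
  by_contra hcon
  exact hω ⟨hl, hcon⟩

end ModulatedTandem

/-! ### Decomposition of paths by the first hitting time. -/

namespace TandemState

variable {S : Type*}

/-- The paths that hit `∂B` for the first time at time `n`. -/
def hitAt (S : Type*) (n : ℕ) : Set (ℕ → TandemState S) :=
  {ω | ω n ∈ boundaryB S ∧ ∀ k < n, ω k ∉ boundaryB S}

/-- The paths that stay in the interior of `B` before time `n`. -/
def insideBefore (S : Type*) (n : ℕ) : Set (ℕ → TandemState S) :=
  {ω | ∀ k < n, 0 < (ω k).level}

theorem measurableSet_coord (n : ℕ) (A : Set (TandemState S)) :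
    MeasurableSet {ω : ℕ → TandemState S | ω n ∈ A} :=
  measurable_pi_apply n (MeasurableSet.of_discrete (s := A))

theorem measurableSet_hitAt (n : ℕ) : MeasurableSet (hitAt S n) := by
  have : hitAt S n = {ω | ω n ∈ boundaryB S} ∩ ⋂ k, ⋂ _ : k < n, {ω | ω k ∈ (boundaryB S)ᶜ} := by
    ext ω
    simp [hitAt]
  rw [this]
  exact (measurableSet_coord _ _).inter
    (MeasurableSet.iInter fun k => MeasurableSet.iInter fun _ => measurableSet_coord _ _)

/-- Being inside before `n + 1` involves the times `0, …, n`, so it is known at time `n` and the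
Markov property applies to it. -/
theorem measurableSet_piLE_insideBefore_succ (n : ℕ) :
    MeasurableSet[Filtration.piLE (X := fun _ : ℕ => TandemState S) n] (insideBefore S (n + 1)) := by
  have : insideBefore S (n + 1) = ⋂ k, ⋂ _ : k ≤ n, {ω | ω k ∈ {z | 0 < z.level}} := by
    ext ω
    simp [insideBefore]
  rw [this]
  refine MeasurableSet.iInter fun k => MeasurableSet.iInter fun hk => ?_
  exact ModulatedTandem.measurableSet_piLE hk _

theorem measurableSet_insideBefore (n : ℕ) : MeasurableSet (insideBefore S n) := by
  cases n with
  | zero => simp [insideBefore]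
  | succ n => exact Filtration.piLE.le n _ (measurableSet_piLE_insideBefore_succ n)

theorem disjoint_hitAt : Pairwise (Function.onFun Disjoint (hitAt S)) := by
  intro m n hmn
  refine Set.disjoint_left.2 fun ω hm hn => ?_
  rcases lt_or_gt_of_ne hmn with h | h
  · exact hn.2 m h hm.1
  · exact hm.2 n h hn.1

theorem tau_of_mem_hitAt {ω : ℕ → TandemState S} {n : ℕ} (h : ω ∈ hitAt S n) :
    tau ω = (n : WithTop ℕ) := by
  refine le_antisymm (hittingAfter_le_of_mem (Nat.zero_le n) h.1) (not_lt.1 fun hlt => ?_)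
  obtain ⟨j, hj, hjB⟩ := hittingAfter_lt_iff.1 hlt
  exact h.2 j hj.2 hjB

theorem tau_lt_top_iff {ω : ℕ → TandemState S} : tau ω < ⊤ ↔ ∃ n, ω n ∈ boundaryB S := by
  rw [lt_top_iff_ne_top, tau, ne_eq, hittingAfter_eq_top_iff]
  simp

theorem setOf_tau_lt_top : {ω : ℕ → TandemState S | tau ω < ⊤} = ⋃ n, hitAt S n := by
  classical
  ext ω
  rw [Set.mem_ofPred_eq, tau_lt_top_iff, Set.mem_iUnion]
  refine ⟨fun h => ⟨Nat.find h, Nat.find_spec h, fun k hk => Nat.find_min h hk⟩, ?_⟩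
  rintro ⟨n, hn⟩
  exact ⟨n, hn.1⟩

end TandemState

/-! ### Optional stopping at `τ`. -/

namespace ModulatedTandem

open TandemState

variable {S : Type*} [Fintype S] [DecidableEq S] (W : ModulatedTandem S)

-- Without jumps across `∂B`, a path from `B` that has avoided `∂B` so far has kept its level
-- positive.
omit [Fintype S] [DecidableEq S] in
theorem insideBefore_of_notMem {ω : ℕ → TandemState S} (h0 : ω 0 ∈ regionB S)
    (hstep : ∀ n, 0 < (ω n).level → ω (n + 1) ∈ regionB S) (n : ℕ)
    (hn : ∀ k < n, ω k ∉ boundaryB S) : ω ∈ insideBefore S n ∧ ω n ∈ regionB S := by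
  induction n with
  | zero => exact ⟨fun k hk => absurd hk (Nat.not_lt_zero k), h0⟩
  | succ n ih =>
    obtain ⟨h1, h2⟩ := ih fun k hk => hn k (hk.trans n.lt_succ_self)
    have h3 : 0 < (ω n).level := lt_of_le_of_ne (mem_regionB_iff.1 h2)
      fun h => hn n n.lt_succ_self (mem_boundaryB_iff.2 h.symm)
    refine ⟨fun k hk => ?_, hstep n h3⟩
    rcases (Nat.lt_succ_iff_lt_or_eq.1 hk) with h | rfl
    · exact h1 k h
    · exact h3

theorem inter_boundary_ae_eq_hitAt {s : TandemState S} (hs : s ∈ regionB S) (n : ℕ) :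
    (insideBefore S n ∩ {ω | ω n ∈ boundaryB S} : Set (ℕ → TandemState S)) =ᵐ[W.pathLaw s]
      hitAt S n := by
  filter_upwards [W.pathLaw_ae_zero s, W.pathLaw_ae_succ s] with ω h0 hstep
  refine propext ⟨fun h => ⟨h.2, fun k hk hB => ?_⟩, fun h => ⟨?_, h.1⟩⟩
  · exact (h.1 k hk).ne' (mem_boundaryB_iff.1 hB)
  · exact (insideBefore_of_notMem (h0 ▸ hs) hstep n h.2).1

/-- With the preceding lemma this splits the paths inside before `n`, up to null sets, into those
hitting at `n` and those inside before `n + 1`. -/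
theorem diff_boundary_ae_eq_insideBefore {s : TandemState S} (hs : s ∈ regionB S) (n : ℕ) :
    (insideBefore S n \ {ω | ω n ∈ boundaryB S} : Set (ℕ → TandemState S)) =ᵐ[W.pathLaw s]
      insideBefore S (n + 1) := by
  filter_upwards [W.pathLaw_ae_zero s, W.pathLaw_ae_succ s] with ω h0 hstep
  refine propext ⟨fun h => ?_, fun h => ⟨fun k hk => h k (hk.trans n.lt_succ_self), fun hB => ?_⟩⟩
  · refine (insideBefore_of_notMem (h0 ▸ hs) hstep (n + 1) fun k hk hB => ?_).1
    rcases (Nat.lt_succ_iff_lt_or_eq.1 hk) with h' | rfl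
    · exact (h.1 k h').ne' (mem_boundaryB_iff.1 hB)
    · exact h.2 hB
  · exact (h n n.lt_succ_self).ne' (mem_boundaryB_iff.1 hB)

omit [DecidableEq S] in
theorem exists_pos_le_rate [Nonempty S] : ∃ δ : ℝ, 0 < δ ∧ ∀ m, δ ≤ W.P m m * W.lam m := by
  obtain ⟨m, hm⟩ := Finite.exists_min fun m => W.P m m * W.lam m
  exact ⟨_, mul_pos (W.P_diag_pos m) (W.lam_pos m), hm⟩

/-- The events are disjoint, so their probabilities are summable. -/
theorem tendsto_measureReal_hitAt (s : TandemState S) :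
    Tendsto (fun n => (W.pathLaw s).real (hitAt S n)) atTop (𝓝 0) := by
  have h := hasSum_integral_iUnion (μ := W.pathLaw s) (f := fun _ => (1 : ℝ))
    (s := hitAt S) measurableSet_hitAt disjoint_hitAt (integrable_const _)
  simpa using h.summable.tendsto_atTop_zero

/-- Paths that stay in the interior of `B` leave every bounded range of levels. -/
theorem tendsto_measureReal_level_le (s : TandemState S) (J : ℕ) :
    Tendsto (fun n => (W.pathLaw s).real
      (insideBefore S (n + 1) ∩ {ω | ω n ∈ {z : TandemState S | z.level ≤ J}})) atTop (𝓝 0) := by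
  have : Nonempty S := ⟨s.mode⟩
  obtain ⟨δ, hδ, hδm⟩ := W.exists_pos_le_rate
  induction J with
  | zero =>
    have : ∀ n, (insideBefore S (n + 1) ∩ {ω | ω n ∈ {z : TandemState S | z.level ≤ (0 : ℕ)}}) = ∅ :=
      fun n => by
        ext ω
        simp only [Set.mem_inter_iff, Set.mem_ofPred_eq, Set.mem_empty_iff_false, iff_false,
          not_and, not_le]
        intro h
        exact h n n.lt_succ_self
    simp only [this, measureReal_empty]
    exact tendsto_const_nhds
  | succ J ih =>
    -- From a level between `1` and `J + 1` a left jump, of probability at least `δ`, either hits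
    -- `∂B` for the first time or stays inside at level at most `J`. Both probabilities tend to
    -- zero, and they dominate `δ` times the one at hand.
    have h1 := ((tendsto_add_atTop_iff_nat 1).2 (W.tendsto_measureReal_hitAt s)).add
      ((tendsto_add_atTop_iff_nat 1).2 ih)
    have h2 := h1.const_mul δ⁻¹
    rw [add_zero, mul_zero] at h2
    refine squeeze_zero (fun _ => measureReal_nonneg) (fun n => ?_) h2
    rw [← div_eq_inv_mul, le_div_iff₀ hδ, mul_comm]
    refine (W.mul_le_measureReal_pathLaw_succ s
      (A := {z | 0 ≤ z.level ∧ z.level ≤ J})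
      (MeasurableSet.inter (measurableSet_piLE_insideBefore_succ n)
        (measurableSet_piLE le_rfl _)) fun ω hω => ?_).trans ?_
    · refine (hδm _).trans (W.le_stepKernel_real ?_)
      have h3 := hω.1 n n.lt_succ_self
      have h4 : (ω n).level ≤ (J + 1 : ℕ) := hω.2
      simp only [Set.mem_ofPred_eq, level_jump_left]
      push_cast at h4
      omega
    · refine (measureReal_mono ?_).trans (measureReal_union_le _ _)
      rintro ω ⟨⟨h3, -⟩, h4, h5⟩
      rcases h4.eq_or_lt with h6 | h6
      · exact Or.inl ⟨mem_boundaryB_iff.2 h6.symm,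
          fun k hk hB => (h3 k hk).ne' (mem_boundaryB_iff.1 hB)⟩
      · refine Or.inr ⟨fun k hk => ?_, h5⟩
        rcases (Nat.lt_succ_iff_lt_or_eq.1 hk) with h | rfl
        · exact h3 k h
        · exact h6

variable {W}

/-- `h` is bounded only on `B`, hence the truncation by the indicator; a step from a positive level
stays in `B`, so harmonicity is not affected. -/
theorem IsHarmonic.setIntegral_insideBefore_succ {h : TandemState S → ℝ} (hh : W.IsHarmonic h)
    {C : ℝ} (hC : ∀ z ∈ regionB S, |h z| ≤ C) (s : TandemState S) (n : ℕ) :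
    ∫ ω in insideBefore S (n + 1), (regionB S).indicator h (ω n) ∂(W.pathLaw s) =
      ∫ ω in insideBefore S (n + 1), (regionB S).indicator h (ω (n + 1)) ∂(W.pathLaw s) := by
  have hC' : ∀ z, |(regionB S).indicator h z| ≤ max C 0 := fun z => by
    by_cases hz : z ∈ regionB S
    · simpa [hz] using Or.inl (hC z hz)
    · simp [hz]
  rw [W.setIntegral_pathLaw_succ s (measurableSet_piLE_insideBefore_succ n) hC']
  refine setIntegral_congr_fun (measurableSet_insideBefore _) fun ω hω => ?_
  have hl := hω n n.lt_succ_self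
  change _ = ∫ z, (regionB S).indicator h z ∂(W.stepKernel (ω n))
  rw [W.integral_stepKernel_congr hl (h := h) fun z hz => Set.indicator_of_mem hz h, hh,
    Set.indicator_of_mem (mem_regionB_iff.2 hl.le)]

/-- This is optional stopping at `τ ∧ n`: the sum collects the paths with `τ < n`, the last integral
those with `τ ≥ n`. -/
theorem IsHarmonic.sum_setIntegral_hitAt {h : TandemState S → ℝ} (hh : W.IsHarmonic h)
    {C : ℝ} (hC : ∀ z ∈ regionB S, |h z| ≤ C) {s : TandemState S} (hs : s ∈ regionB S) (n : ℕ) :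
    ∑ k ∈ Finset.range n, ∫ ω in hitAt S k, (regionB S).indicator h (ω k) ∂(W.pathLaw s) +
      ∫ ω in insideBefore S n, (regionB S).indicator h (ω n) ∂(W.pathLaw s) = h s := by
  have hm : Measurable ((regionB S).indicator h) := measurable_from_top
  have hint : ∀ k, Integrable (fun ω : ℕ → TandemState S => (regionB S).indicator h (ω k))
      (W.pathLaw s) := fun k => by
    refine Integrable.of_bound (hm.comp (measurable_pi_apply k)).aestronglyMeasurable (max C 0)
      (Eventually.of_forall fun ω => ?_)
    by_cases hz : ω k ∈ regionB S
    · simpa [hz] using Or.inl (hC _ hz)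
    · simp [hz]
  induction n with
  | zero =>
    have h0 : insideBefore S 0 = Set.univ := by
      ext
      simp [insideBefore]
    rw [Finset.sum_range_zero, zero_add, h0, setIntegral_univ,
      integral_congr_ae ((W.pathLaw_ae_zero s).mono fun ω hω => by
        rw [hω, Set.indicator_of_mem hs])]
    simp
  | succ n ih =>
    rw [Finset.sum_range_succ, add_assoc, ← hh.setIntegral_insideBefore_succ hC, ← ih]
    congr 1
    rw [← integral_inter_add_sdiff (s := insideBefore S n)
      (measurableSet_coord n (boundaryB S)) (hint n).integrableOn,
      setIntegral_congr_set (W.inter_boundary_ae_eq_hitAt hs n),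
      setIntegral_congr_set (W.diff_boundary_ae_eq_insideBefore hs n)]

/-- Split at a level `J` with `C * r ^ J` small: above it the integrand is small, below it the event
has vanishing probability. -/
theorem tendsto_setIntegral_insideBefore {h : TandemState S → ℝ}
    {C r : ℝ} (hC : 0 ≤ C) (hr0 : 0 < r) (hr1 : r < 1)
    (hb : ∀ z ∈ regionB S, |h z| ≤ C * r ^ z.level) (s : TandemState S) :
    Tendsto (fun n => ∫ ω in insideBefore S (n + 1), (regionB S).indicator h (ω n)
      ∂(W.pathLaw s)) atTop (𝓝 0) := by
  rw [Metric.tendsto_atTop]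
  intro ε hε
  have hJ : ∀ᶠ J : ℕ in atTop, C * r ^ J < ε / 2 := by
    have := (tendsto_pow_atTop_nhds_zero_of_lt_one hr0.le hr1).const_mul C
    rw [mul_zero] at this
    exact this.eventually_lt_const (half_pos hε)
  obtain ⟨J, hJ⟩ := hJ.exists
  have h1 := (W.tendsto_measureReal_level_le s J).const_mul C
  rw [mul_zero] at h1
  obtain ⟨N, hN⟩ := eventually_atTop.1 (h1.eventually_lt_const (half_pos hε))
  refine ⟨N, fun n hn => ?_⟩
  rw [dist_zero_right]
  set E : Set (ℕ → TandemState S) := {ω | ω n ∈ {z : TandemState S | z.level ≤ J}}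
  have hE : MeasurableSet E := measurableSet_coord _ _
  have hbound : ∀ ω ∈ insideBefore S (n + 1),
      ‖(regionB S).indicator h (ω n)‖ ≤ E.indicator (fun _ => C) ω + C * r ^ J := fun ω hω => by
    have hl := hω n n.lt_succ_self
    have hB : ω n ∈ regionB S := mem_regionB_iff.2 hl.le
    rw [Set.indicator_of_mem hB]
    refine (hb _ hB).trans ?_
    by_cases hωE : ω ∈ E
    · rw [Set.indicator_of_mem hωE]
      have h2 : r ^ (ω n).level ≤ 1 := (zpow_le_zpow_right_of_le_one₀ hr0 hr1.le hl.le).trans_eq (zpow_zero r)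
      have h3 : 0 ≤ C * r ^ J := by positivity
      nlinarith
    · rw [Set.indicator_of_notMem hωE, zero_add, ← zpow_natCast]
      refine mul_le_mul_of_nonneg_left ?_ hC
      have h4 : ¬ (ω n).level ≤ J := hωE
      exact zpow_le_zpow_right_of_le_one₀ hr0 hr1.le (by omega)
  have hint : Integrable (fun ω => E.indicator (fun _ => C) ω + C * r ^ J) (W.pathLaw s) :=
    ((integrable_const C).indicator hE).add (integrable_const _)
  calc ‖∫ ω in insideBefore S (n + 1), (regionB S).indicator h (ω n) ∂(W.pathLaw s)‖
      ≤ ∫ ω in insideBefore S (n + 1), (E.indicator (fun _ => C) ω + C * r ^ J)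
          ∂(W.pathLaw s) :=
        norm_integral_le_of_norm_le hint.integrableOn
          ((ae_restrict_iff' (measurableSet_insideBefore _)).2 (Eventually.of_forall hbound))
    _ = C * (W.pathLaw s).real (insideBefore S (n + 1) ∩ E) +
          C * r ^ J * (W.pathLaw s).real (insideBefore S (n + 1)) := by
        rw [integral_add ((integrable_const C).indicator hE).integrableOn
          (integrable_const _).integrableOn, integral_indicator_const _ hE,
          measureReal_restrict_apply hE, Set.inter_comm]
        simp [mul_comm]
    _ ≤ C * (W.pathLaw s).real (insideBefore S (n + 1) ∩ E) + C * r ^ J := by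
        refine add_le_add_right (mul_le_of_le_one_right (by positivity) ?_) _
        exact measureReal_le_one
    _ < ε / 2 + ε / 2 := add_lt_add (hN n hn) hJ
    _ = ε := add_halves ε

/-- A harmonic function that decays exponentially in the level is `∂B`-determined. -/
theorem IsHarmonic.eq_setIntegral_tau {h : TandemState S → ℝ} (hh : W.IsHarmonic h)
    {C r : ℝ} (hC : 0 ≤ C) (hr0 : 0 < r) (hr1 : r < 1)
    (hb : ∀ z ∈ regionB S, |h z| ≤ C * r ^ z.level) {s : TandemState S} (hs : s ∈ regionB S) :
    IntegrableOn (fun ω => h (ω (tau ω).untopA)) {ω | tau ω < ⊤} (W.pathLaw s) ∧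
    h s = ∫ ω in {ω | tau ω < ⊤}, h (ω (tau ω).untopA) ∂(W.pathLaw s) := by
  have hbC : ∀ z ∈ regionB S, |h z| ≤ C := fun z hz => (hb z hz).trans
    (mul_le_of_le_one_right hC
      ((zpow_le_zpow_right_of_le_one₀ hr0 hr1.le (mem_regionB_iff.1 hz)).trans_eq (zpow_zero r)))
  have heq : ∀ n, ∀ ω ∈ hitAt S n,
      h (ω (tau ω).untopA) = (regionB S).indicator h (ω n) := fun n ω hω => by
    rw [tau_of_mem_hitAt hω, show ((n : WithTop ℕ)).untopA = n from rfl,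
      Set.indicator_of_mem (mem_regionB_iff.2 (mem_boundaryB_iff.1 hω.1).ge)]
  have hm : Measurable ((regionB S).indicator h) := measurable_from_top
  have hI : IntegrableOn (fun ω => h (ω (tau ω).untopA)) (⋃ n, hitAt S n) (W.pathLaw s) := by
    refine Integrable.of_bound (aestronglyMeasurable_iUnion_iff.2 fun n => ?_) C
      ((ae_restrict_iff' (MeasurableSet.iUnion measurableSet_hitAt)).2
        (Eventually.of_forall fun ω hω => ?_))
    · refine AEStronglyMeasurable.congr
        (hm.comp (measurable_pi_apply n)).aestronglyMeasurable ?_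
      exact (ae_restrict_iff' (measurableSet_hitAt n)).2
        (Eventually.of_forall fun ω hω => (heq n ω hω).symm)
    · obtain ⟨n, hn⟩ := Set.mem_iUnion.1 hω
      have hB : ω n ∈ regionB S := mem_regionB_iff.2 (mem_boundaryB_iff.1 hn.1).ge
      rw [heq n ω hn, Set.indicator_of_mem hB]
      exact hbC _ hB
  rw [setOf_tau_lt_top]
  refine ⟨hI, ?_⟩
  have h1 := (hasSum_integral_iUnion measurableSet_hitAt disjoint_hitAt hI).tendsto_sum_nat
  have h2 : Tendsto (fun n => ∫ ω in insideBefore S (n + 1), (regionB S).indicator h (ω (n + 1))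
      ∂(W.pathLaw s)) atTop (𝓝 0) :=
    (tendsto_setIntegral_insideBefore hC hr0 hr1 hb s).congr fun n =>
      hh.setIntegral_insideBefore_succ hbC s n
  have h3 := h1.add ((tendsto_add_atTop_iff_nat (f := fun n => ∫ ω in insideBefore S n,
    (regionB S).indicator h (ω n) ∂(W.pathLaw s)) 1).1 h2)
  rw [add_zero] at h3
  refine tendsto_nhds_unique (tendsto_const_nhds.congr fun n => ?_) h3
  rw [← hh.sum_setIntegral_hitAt hbC hs n]
  congr 1
  exact Finset.sum_congr rfl fun k _ =>
    setIntegral_congr_fun (measurableSet_hitAt k) fun ω hω => (heq k ω hω).symm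

variable (W)

/-- A run of `s.level` consecutive left jumps reaches `∂B`, and each has probability at least `δ`.
-/
theorem hitProb_pos {s : TandemState S} (hs : s ∈ regionB S) : 0 < W.hitProb s := by
  have : Nonempty S := ⟨s.mode⟩
  obtain ⟨δ, hδ, hδm⟩ := W.exists_pos_le_rate
  have h : ∀ n : ℕ, δ ^ n ≤ (W.pathLaw s).real
      {ω | ω n ∈ {z : TandemState S | z.level = s.level - n}} := fun n => by
    induction n with
    | zero =>
      have : (W.pathLaw s).real {ω | ω 0 ∈ {z : TandemState S | z.level = s.level - (0 : ℕ)}} =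
          (W.pathLaw s).real Set.univ := by
        refine measureReal_congr ?_
        filter_upwards [W.pathLaw_ae_zero s] with ω hω
        refine propext ⟨fun _ => trivial, fun _ => ?_⟩
        change (ω 0).level = _
        simp [hω]
      rw [this]
      simp
    | succ n ih =>
      calc δ ^ (n + 1) = δ * δ ^ n := pow_succ' δ n
        _ ≤ δ * _ := mul_le_mul_of_nonneg_left ih hδ.le
        _ ≤ _ := W.mul_le_measureReal_pathLaw_succ s (measurableSet_piLE le_rfl _)
          (A := {z : TandemState S | z.level = s.level - (n + 1 : ℕ)}) fun ω hω => by
            refine (hδm _).trans (W.le_stepKernel_real ?_)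
            have h3 : (ω n).level = s.level - n := hω
            simp only [Set.mem_ofPred_eq, level_jump_left]
            push_cast
            omega
        _ ≤ _ := measureReal_mono Set.inter_subset_right
  have hl := mem_regionB_iff.1 hs
  refine (pow_pos hδ s.level.toNat).trans_le ((h _).trans (measureReal_mono fun ω hω => ?_))
  have h1 : (ω s.level.toNat).level = s.level - (s.level.toNat : ℤ) := hω
  refine tau_lt_top_iff.2 ⟨s.level.toNat, mem_boundaryB_iff.2 ?_⟩
  omega

end ModulatedTandem

/-! ### Exponential decay in the level. -/

namespace TandemState

variable {S : Type*}

/-- Exponential decay in the level on `B`. -/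
def LevelDecay (h : TandemState S → ℝ) : Prop :=
  ∃ C r : ℝ, 0 ≤ C ∧ 0 < r ∧ r < 1 ∧ ∀ z ∈ regionB S, |h z| ≤ C * r ^ z.level

theorem LevelDecay.const_mul {h : TandemState S → ℝ} (hh : LevelDecay h) (c : ℝ) :
    LevelDecay fun z => c * h z := by
  obtain ⟨C, r, hC, hr0, hr1, hb⟩ := hh
  refine ⟨|c| * C, r, by positivity, hr0, hr1, fun z hz => ?_⟩
  rw [abs_mul, mul_assoc]
  exact mul_le_mul_of_nonneg_left (hb z hz) (abs_nonneg c)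

theorem LevelDecay.add {g h : TandemState S → ℝ} (hg : LevelDecay g) (hh : LevelDecay h) :
    LevelDecay fun z => g z + h z := by
  obtain ⟨C, r, hC, hr0, hr1, hb⟩ := hg
  obtain ⟨C', r', hC', hr0', hr1', hb'⟩ := hh
  refine ⟨C + C', max r r', by positivity, lt_max_of_lt_left hr0, max_lt hr1 hr1',
    fun z hz => ?_⟩
  have hl := mem_regionB_iff.1 hz
  rw [add_mul]
  refine (abs_add_le _ _).trans (add_le_add ((hb z hz).trans ?_) ((hb' z hz).trans ?_))
  · exact mul_le_mul_of_nonneg_left (zpow_le_zpow_left₀ hl hr0.le (le_max_left _ _)) hC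
  · exact mul_le_mul_of_nonneg_left (zpow_le_zpow_left₀ hl hr0'.le (le_max_right _ _)) hC'

theorem LevelDecay.sum {ι : Type*} (t : Finset ι) {h : ι → TandemState S → ℝ}
    (hh : ∀ i ∈ t, LevelDecay (h i)) : LevelDecay fun z => ∑ i ∈ t, h i z := by
  classical
  induction t using Finset.induction_on with
  | empty => exact ⟨0, 1 / 2, le_rfl, by norm_num, by norm_num, fun z _ => by simp⟩
  | insert i t hi ih =>
    simp only [Finset.sum_insert hi]
    exact (hh i (Finset.mem_insert_self i t)).add
      (ih fun j hj => hh j (Finset.mem_insert_of_mem hj))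

theorem levelDecay_expFun [Fintype S] {β α : ℝ} (hβ : 0 < β) (hβ1 : β < 1) (hα : 0 < α)
    (hα1 : α ≤ 1) (d : S → ℝ) : LevelDecay (expFun β α d) := by
  refine ⟨∑ m, |d m|, β, Finset.sum_nonneg fun _ _ => abs_nonneg _, hβ, hβ1, fun z _ => ?_⟩
  have h1 : |d z.mode| ≤ ∑ m, |d m| :=
    Finset.single_le_sum (f := fun m => |d m|) (fun _ _ => abs_nonneg _) (Finset.mem_univ _)
  have h2 : α ^ z.y2 ≤ 1 := pow_le_one₀ hα.le hα1
  have h3 : 0 < β ^ (z.y1 - (z.y2 : ℤ)) := zpow_pos hβ _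
  rw [expFun, abs_mul, abs_mul, abs_of_pos h3, abs_of_pos (pow_pos hα _)]
  calc β ^ (z.y1 - (z.y2 : ℤ)) * α ^ z.y2 * |d z.mode|
      ≤ β ^ (z.y1 - (z.y2 : ℤ)) * 1 * ∑ m, |d m| := by gcongr
    _ = (∑ m, |d m|) * β ^ z.level := by rw [mul_one, mul_comm]; rfl

theorem expFun_of_mem_boundaryB {s : TandemState S} (hs : s ∈ boundaryB S) (β α : ℝ) (d : S → ℝ) :
    expFun β α d s = α ^ s.y2 * d s.mode := by
  have h : s.y1 - (s.y2 : ℤ) = 0 := mem_boundaryB_iff.1 hs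
  rw [expFun, h, zpow_zero, one_mul]

end TandemState

/-! ### Harmonicity of the combinations and comparison with the hitting probability. -/

namespace ModulatedTandem

open TandemState

variable {S : Type*} [Fintype S] [DecidableEq S] {W : ModulatedTandem S}

/-- One-step expectation of an exponential function attached to a point of the characteristic
surface: harmonicity fails on the constraining boundary only, by the vector `cVec`. -/
theorem integral_stepKernel_expFun {β α : ℝ} (hβ : 0 < β) (hα : 0 < α) {d : S → ℝ}
    (hd : (W.charMat β α).mulVec d = d) (s : TandemState S) :
    ∫ z, expFun β α d z ∂(W.stepKernel s) =
      expFun β α d s + if s.y2 = 0 then β ^ s.y1 * W.cVec β α d s.mode else 0 := by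
  have h1 : expFun β α d s = ∑ n, β ^ (s.y1 - (s.y2 : ℤ)) * α ^ s.y2 *
      (W.charMat β α s.mode n * d n) := by
    rw [← Finset.mul_sum]
    exact congrArg (fun x => β ^ (s.y1 - (s.y2 : ℤ)) * α ^ s.y2 * x) (congrFun hd s.mode).symm
  have h2 : (if s.y2 = 0 then β ^ s.y1 * W.cVec β α d s.mode else 0) =
      ∑ n, if n = s.mode then (if s.y2 = 0 then β ^ s.y1 * W.cVec β α d s.mode else 0) else 0 := by
    simp
  rw [integral_stepKernel, h1, h2, ← Finset.sum_add_distrib]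
  refine Finset.sum_congr rfl fun n _ => ?_
  by_cases hn : n = s.mode
  · subst hn
    rw [if_pos rfl, if_pos rfl, jump_left, jump_up, charMat_diag]
    have e1 : β ^ (s.y1 - 1 - (s.y2 : ℤ)) = β ^ (s.y1 - (s.y2 : ℤ)) * (1 / β) := by
      rw [show s.y1 - 1 - (s.y2 : ℤ) = s.y1 - (s.y2 : ℤ) - 1 by ring, zpow_sub_one₀ hβ.ne',
        one_div]
    have e2 : s.y1 + 1 - ((s.y2 + 1 : ℕ) : ℤ) = s.y1 - (s.y2 : ℤ) := by
      push_cast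
      ring
    by_cases hy : s.y2 = 0
    -- The suppressed jump contributes `μ₂` where the matrix has `μ₂ β/α`; the difference is `cVec`.
    · rw [if_pos hy, jump_down_zero s hy]
      rw [hy, Nat.cast_zero, sub_zero, sub_zero] at e1
      simp only [expFun, e1, hy, cVec, Nat.cast_zero, sub_zero, zero_add, Nat.cast_one,
        add_sub_cancel_right]
      ring
    · rw [if_neg hy, jump_down s hy]
      have e3 : s.y1 - ((s.y2 - 1 : ℕ) : ℤ) = s.y1 - (s.y2 : ℤ) + 1 := by omega
      have e4 : α ^ s.y2 = α ^ (s.y2 - 1) * α := by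
        rw [← pow_succ, Nat.sub_add_cancel (Nat.one_le_iff_ne_zero.2 hy)]
      simp only [expFun, e1, e2, e3, zpow_add_one₀ hβ.ne', pow_succ, e4]
      field_simp
      ring
  · rw [if_neg hn, if_neg hn, charMat_off _ _ _ (Ne.symm hn)]
    simp only [expFun]
    ring

theorem IsHarmonic.isBoundaryDetermined {h : TandemState S → ℝ} (hh : W.IsHarmonic h)
    (hd : LevelDecay h) : W.IsBoundaryDetermined h := by
  obtain ⟨C, r, hC, hr0, hr1, hb⟩ := hd
  exact ⟨hh, h, fun s hs => hh.eq_setIntegral_tau hC hr0 hr1 hb hs⟩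

theorem IsHarmonic.const_mul_add {g h : TandemState S → ℝ} (hg : W.IsHarmonic g)
    (hh : W.IsHarmonic h) (a c : ℝ) : W.IsHarmonic fun s => a * (g s + c * h s) := fun s => by
  rw [integral_const_mul, integral_add (W.integrable_stepKernel g s)
    (W.integrable_stepKernel _ s), integral_const_mul, hg s, hh s]

/-- A harmonic function with exponential decay is comparable to the hitting probability as soon as
it is so on `∂B`. -/
theorem IsHarmonic.hitProb_bounds {h : TandemState S → ℝ} (hh : W.IsHarmonic h)
    (hd : LevelDecay h) (h2 : ∀ z ∈ boundaryB S, 2 ≤ h z) :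
    ∃ c : ℝ, ∀ s ∈ regionB S, W.hitProb s < h s ∧ h s < c * W.hitProb s := by
  obtain ⟨C, r, hC, hr0, hr1, hb⟩ := hd
  -- On `∂B` the level is zero, so `h ≤ C` there. The slack in `2` and `C + 1`, with a positive
  -- hitting probability, makes both inequalities strict.
  refine ⟨C + 1, fun s hs => ?_⟩
  have hp := W.hitProb_pos hs
  obtain ⟨hI, heq⟩ := hh.eq_setIntegral_tau hC hr0 hr1 hb hs
  have hm : MeasurableSet {ω : ℕ → TandemState S | tau ω < ⊤} := by
    rw [setOf_tau_lt_top]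
    exact MeasurableSet.iUnion measurableSet_hitAt
  have hmem : ∀ ω : ℕ → TandemState S, tau ω < ⊤ → ω (tau ω).untopA ∈ boundaryB S :=
    fun ω hω => hittingAfter_mem_set_of_ne_top hω.ne
  have hconst : ∀ c : ℝ, ∫ _ in {ω : ℕ → TandemState S | tau ω < ⊤}, c ∂(W.pathLaw s) =
      c * W.hitProb s := fun c => by
    rw [setIntegral_const, smul_eq_mul, mul_comm]
    rfl
  have hlow : 2 * W.hitProb s ≤ h s := by
    rw [heq, ← hconst]
    exact setIntegral_mono_on (integrable_const _).integrableOn hI hm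
      fun ω hω => h2 _ (hmem ω hω)
  have hup : h s ≤ C * W.hitProb s := by
    rw [heq, ← hconst]
    refine setIntegral_mono_on hI (integrable_const _).integrableOn hm fun ω hω => ?_
    have hB := mem_boundaryB_iff.1 (hmem ω hω)
    have := hb _ (mem_regionB_iff.2 hB.ge)
    rw [hB, zpow_zero, mul_one] at this
    exact (le_abs_self _).trans this
  constructor <;> nlinarith

namespace ConjugatePoints

variable (C : W.ConjugatePoints)

theorem α_pos (j : Fin (Fintype.card S)) : 0 < C.α j := (C.α_level j).2.1

theorem α_lt_one (j : Fin (Fintype.card S)) : C.α j < 1 := by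
  by_cases hj : (j : ℕ) = 0
  · exact C.α_first j hj
  · exact (C.α_lt ⟨0, j.pos⟩ j rfl hj).trans (C.α_first _ rfl)

variable {C}

/-- All terms share `β = ρ₂`, so the defects have the common factor `ρ₂ ^ y1` and can cancel for all
`y1` at once. -/
theorem integral_hRho2 (hρ : W.IsRho2 W.rho2) (b : Fin (Fintype.card S) → ℝ) (s : TandemState S) :
    ∫ z, C.hRho2 b z ∂(W.stepKernel s) = C.hRho2 b s + if s.y2 = 0 then W.rho2 ^ s.y1 *
      (W.cVec W.rho2 1 C.d2 + ∑ j, b j • W.cVec W.rho2 (C.α j) (C.e j)) s.mode else 0 := by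
  simp only [hRho2]
  rw [integral_add (W.integrable_stepKernel _ s) (W.integrable_stepKernel _ s),
    integral_finsetSum _ fun j _ => W.integrable_stepKernel _ s,
    integral_stepKernel_expFun hρ.1 one_pos C.d2_eig]
  simp only [integral_const_mul, integral_stepKernel_expFun hρ.1 (C.α_pos _) (C.e_eig _)]
  by_cases hy : s.y2 = 0
  · simp only [hy, if_true, mul_add, Finset.sum_add_distrib, Pi.add_apply, Finset.sum_apply,
      Pi.smul_apply, smul_eq_mul, Finset.mul_sum]
    have : ∀ j, b j * (W.rho2 ^ s.y1 * W.cVec W.rho2 (C.α j) (C.e j) s.mode) =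
        W.rho2 ^ s.y1 * (b j * W.cVec W.rho2 (C.α j) (C.e j) s.mode) := fun j => by ring
    simp only [this]
    ring
  · simp [hy]

theorem SpanCondition.exists_isHarmonic (h : C.SpanCondition) (hρ : W.IsRho2 W.rho2) :
    ∃ b, W.IsHarmonic (C.hRho2 b) := by
  obtain ⟨c, hc⟩ := (Submodule.mem_span_range_iff_exists_fun ℝ).1 h
  refine ⟨fun j => -c j, fun s => ?_⟩
  have : W.cVec W.rho2 1 C.d2 + ∑ j, (-c j) • W.cVec W.rho2 (C.α j) (C.e j) = 0 := by
    simp [neg_smul, hc]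
  rw [integral_hRho2 hρ, this]
  simp

variable (C)

theorem levelDecay_hRho2 (hρ : W.IsRho2 W.rho2) (b : Fin (Fintype.card S) → ℝ) :
    LevelDecay (C.hRho2 b) :=
  (levelDecay_expFun hρ.1 hρ.2.1 one_pos le_rfl C.d2).add (LevelDecay.sum _ fun j _ =>
    (levelDecay_expFun hρ.1 hρ.2.1 (C.α_pos j) (C.α_lt_one j).le (C.e j)).const_mul (b j))

theorem levelDecay_hRho1 (hρ : W.IsRho1 W.rho1) : LevelDecay C.hRho1 :=
  levelDecay_expFun hρ.1 hρ.2.1 hρ.1 hρ.2.1.le C.d1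

/-- The factor `1 - β/α` of the defect vanishes at `β = α`. -/
theorem isHarmonic_hRho1 (hρ : W.IsRho1 W.rho1) : W.IsHarmonic C.hRho1 := fun s => by
  rw [hRho1, integral_stepKernel_expFun hρ.1 hρ.1 C.d1_eig]
  simp [cVec, hρ.1.ne']

/-- For a suitable combination of `𝔥_{ρ₂}` and `h_{ρ₁}` the values on `∂B` are at least `2`. -/
theorem exists_two_le_hApprox [Nonempty S] (hρ : W.IsRho1 W.rho1)
    (b : Fin (Fintype.card S) → ℝ) :
    ∃ c10 c11 : ℝ, ∀ z ∈ boundaryB S, 2 ≤ C.hApprox b c10 c11 z := by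
  obtain ⟨m₀, hm₀⟩ := Finite.exists_min C.d2
  -- On `∂B` the values are `d2 + T + c10 * ρ₁ ^ y2 * d1` with `d2 ≥ 2η`. For `y2 ≥ N` the
  -- oscillating part `T` exceeds `-η`; for the finitely many remaining `(y2, m)`, `c10 ≥ c` raises
  -- the value to `η`. Rescaling by `2 / η` gives `2`.
  set η := C.d2 m₀ / 2
  have hη : 0 < η := half_pos (C.d2_pos m₀)
  set T : ℕ → S → ℝ := fun k m => ∑ j, b j * (C.α j ^ k * C.e j m)
  have hT : ∀ m, Tendsto (fun k => T k m) atTop (𝓝 0) := fun m => by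
    have : Tendsto (fun k => T k m) atTop
        (𝓝 (∑ j : Fin (Fintype.card S), b j * (0 * C.e j m))) :=
      tendsto_finsetSum _ fun j _ => ((tendsto_pow_atTop_nhds_zero_of_lt_one (C.α_pos j).le
        (C.α_lt_one j)).mul_const _).const_mul _
    simpa using this
  obtain ⟨N, hN⟩ := eventually_atTop.1
    (eventually_all.2 fun m => (hT m).eventually_const_lt (neg_lt_zero.2 hη))
  obtain ⟨c, hc⟩ := (Set.finite_range fun p : Fin N × S =>
    (η - C.d2 p.2 - T p.1 p.2) / (W.rho1 ^ (p.1 : ℕ) * C.d1 p.2)).bddAbove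
  refine ⟨max c 0, 2 / η, fun z hz => ?_⟩
  have hpos : 0 < W.rho1 ^ z.y2 * C.d1 z.mode := mul_pos (pow_pos hρ.1 _) (C.d1_pos _)
  have hval : C.hRho2 b z + max c 0 * C.hRho1 z =
      C.d2 z.mode + T z.y2 z.mode + max c 0 * (W.rho1 ^ z.y2 * C.d1 z.mode) := by
    simp only [hRho2, hRho1, expFun_of_mem_boundaryB hz, one_pow, one_mul, T]
  have hge : η ≤ C.hRho2 b z + max c 0 * C.hRho1 z := by
    rw [hval]
    rcases le_or_gt N z.y2 with h | h
    · have h1 := hN z.y2 h z.mode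
      have h2 := hm₀ z.mode
      have h3 : C.d2 m₀ = η + η := (add_halves _).symm
      have h4 := mul_nonneg (le_max_right c 0) hpos.le
      linarith
    · have h1 := (hc ⟨(⟨z.y2, h⟩, z.mode), rfl⟩).trans (le_max_left c 0)
      rw [div_le_iff₀ hpos] at h1
      linarith
  rw [hApprox, div_mul_eq_mul_div, le_div_iff₀ hη]
  linarith

end ConjugatePoints

end ModulatedTandem

/-! ### Assembly of the theorem. -/

theorem propositionp {S : Type*} [Fintype S] [DecidableEq S] [Nonempty S]
    (W : ModulatedTandem S) (hirr : W.P.IsIrreducible) (hstab : W.Stable)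
    (hsimple : W.SimpleEigenvalues) (hconj : W.ConjCondition) :
    W.IsRho1 W.rho1 ∧ W.IsRho2 W.rho2 ∧ Nonempty W.ConjugatePoints ∧
    ∀ C : W.ConjugatePoints, C.SpanCondition →
      (∃ b, W.IsBoundaryDetermined (C.hRho2 b)) ∧
      ∀ b, W.IsHarmonic (C.hRho2 b) →
        ∃ c9 c10 c11 : ℝ,
          W.IsBoundaryDetermined (C.hApprox b c10 c11) ∧
          ∀ s ∈ TandemState.regionB S,
            W.hitProb s < C.hApprox b c10 c11 s ∧
            C.hApprox b c10 c11 s < c9 * W.hitProb s := by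
  -- `rho1` and `rho2` are chosen by `Classical.epsilon`, so existence of some suitable number is
  -- what gives them their defining properties.
  have hρ1 : W.IsRho1 W.rho1 :=
    Classical.epsilon_spec (ModulatedTandem.exists_isRho1 hsimple hstab)
  have hρ2 : W.IsRho2 W.rho2 :=
    Classical.epsilon_spec (ModulatedTandem.exists_isRho2 hsimple hstab)
  refine ⟨hρ1, hρ2, ModulatedTandem.nonempty_conjugatePoints hirr hsimple hconj hρ1 hρ2,
    fun C hC => ⟨?_, fun b hb => ?_⟩⟩
  · obtain ⟨b, hb⟩ := hC.exists_isHarmonic hρ2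
    exact ⟨b, hb.isBoundaryDetermined (C.levelDecay_hRho2 hρ2 b)⟩
  · obtain ⟨c10, c11, h2⟩ := C.exists_two_le_hApprox hρ1 b
    have hh : W.IsHarmonic (C.hApprox b c10 c11) :=
      hb.const_mul_add (C.isHarmonic_hRho1 hρ1) c11 c10
    have hd : TandemState.LevelDecay (C.hApprox b c10 c11) :=
      ((C.levelDecay_hRho2 hρ2 b).add ((C.levelDecay_hRho1 hρ1).const_mul c10)).const_mul c11
    obtain ⟨c9, h9⟩ := hh.hitProb_bounds hd h2
    exact ⟨c9, c10, c11, hh.isBoundaryDetermined hd, h9⟩
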